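/- Let $G$ be an infinite, connected, vertex-transitive simple graph all of whose vertex degrees are at most $D$ for some natural number $D$, and let $o$ be any vertex of $G$. Let $\mathcal P(o)$ be the set of finite (self-avoiding) paths in $G$ starting at $o$. The path tree $T(G,o)$ is the graph with vertex set $\mathcal P(o)$ in which two paths are adjacent if and only if one is obtained from the other by appending one edge at its end. Let $A$ be the adjacency operator of $T(G,o)$, a bounded self-adjoint operator on $\ell^2(\mathcal P(o))$ of norm at most $D$, and let $\chi_o$ be the characteristic vector of the one-vertex path $o$. The matching measure $\nu_{G,o}$ is the unique probability measure on $[-D,D]$ such that for all $n\ge 1$ $$\langle A^n\chi_o,\chi_o\rangle=\int_{-D}^{D}x^n\,d\nu_{G,o}(x).$$ Then $\nu_{G,o}$ has no atoms, that is, $\nu_{G,o}(\{\theta\})=0$ for every $\theta\in\mathbb R$. -/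

import Mathlib

open MeasureTheory

/-- All vertices of `G` have degree at most `D`. -/
def HasDegreeBound {V : Type*} (G : SimpleGraph V) (D : ℕ) : Prop :=
  ∀ v : V, (G.neighborSet v).encard ≤ D

/-- `G` is vertex-transitive: its automorphism group acts transitively on the vertices. -/
def IsVertexTransitive {V : Type*} (G : SimpleGraph V) : Prop :=
  ∀ u v : V, ∃ φ : G ≃g G, φ u = v

/-! ### The path tree -/

/-- The finite (self-avoiding) paths of `G` that start at `o`, with an arbitrary end vertex. -/
abbrev PathsFrom {V : Type*} (G : SimpleGraph V) (o : V) : Type _ :=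
  Σ v : V, G.Path o v

/-- The path consisting of the single vertex `o`. -/
def trivialPath {V : Type*} (G : SimpleGraph V) (o : V) : PathsFrom G o :=
  ⟨o, SimpleGraph.Path.nil⟩

/-- `q` is obtained from `p` by appending one edge at its end, that is, `p` is the maximal proper
subpath of `q` among the paths that start at `o`. -/
def ExtendsByEdge {V : Type*} {G : SimpleGraph V} {o : V} (p q : PathsFrom G o) : Prop :=
  ∃ h : G.Adj p.1 q.1, (q.2 : G.Walk o q.1) = (p.2 : G.Walk o p.1).concat h

/-- The path tree `T(G, o)`: its vertices are the finite paths starting at `o`, and two of them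
are adjacent if one extends the other by a single edge. -/
def pathTree {V : Type*} (G : SimpleGraph V) (o : V) : SimpleGraph (PathsFrom G o) where
  Adj p q := ExtendsByEdge p q ∨ ExtendsByEdge q p
  symm := ⟨fun _ _ h => h.symm⟩
  loopless := ⟨fun p h => by
    rcases h with h | h <;> exact h.choose.ne rfl⟩

theorem ExtendsByEdge.end_mem {V : Type*} {G : SimpleGraph V} {o : V} {p q : PathsFrom G o}
    (h : ExtendsByEdge p q) : p.1 ∈ (q.2 : G.Walk o q.1).support := by
  obtain ⟨h, e⟩ := h
  rw [e, SimpleGraph.Walk.support_concat]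
  simp

theorem ExtendsByEdge.end_notMem {V : Type*} {G : SimpleGraph V} {o : V} {p q : PathsFrom G o}
    (h : ExtendsByEdge p q) : q.1 ∉ (p.2 : G.Walk o p.1).support := by
  obtain ⟨h, e⟩ := h
  have hq := q.2.2
  rw [e, SimpleGraph.Walk.concat_isPath_iff] at hq
  exact hq.2

theorem ExtendsByEdge.eq_of_end_eq {V : Type*} {G : SimpleGraph V} {o : V}
    {p q q' : PathsFrom G o} (h : ExtendsByEdge p q) (h' : ExtendsByEdge p q')
    (e : q.1 = q'.1) : q = q' := by
  obtain ⟨v, q⟩ := q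
  obtain ⟨v', q'⟩ := q'
  obtain ⟨a, e1⟩ := h
  obtain ⟨b, e2⟩ := h'
  dsimp only at e a b e1 e2
  cases e
  exact Sigma.ext rfl (heq_of_eq (Subtype.ext (e1.trans e2.symm)))

theorem ExtendsByEdge.unique {V : Type*} {G : SimpleGraph V} {o : V}
    {p q q' : PathsFrom G o} (h : ExtendsByEdge q p) (h' : ExtendsByEdge q' p) : q = q' := by
  obtain ⟨v, q, hq⟩ := q
  obtain ⟨v', q', hq'⟩ := q'
  obtain ⟨a, e1⟩ := h
  obtain ⟨b, e2⟩ := h'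
  dsimp only at a b e1 e2
  obtain ⟨e, e3⟩ := SimpleGraph.Walk.concat_inj (e1.symm.trans e2)
  subst e
  simp only [SimpleGraph.Walk.copy_rfl_rfl] at e3
  subst e3
  rfl

/-- The path tree inherits the degree bound of the graph. -/
theorem HasDegreeBound.pathTree {V : Type*} {G : SimpleGraph V} {D : ℕ}
    (hD : HasDegreeBound G D) (o : V) : HasDegreeBound (pathTree G o) D := by
  intro p
  refine le_trans ?_ (hD p.1)
  have hinj : Set.InjOn (fun q : PathsFrom G o => q.1)
      ((_root_.pathTree G o).neighborSet p) := by
    intro q hq q' hq' e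
    dsimp only at e
    rcases hq with hq | hq <;> rcases hq' with hq' | hq'
    · exact hq.eq_of_end_eq hq' e
    · exact absurd (e ▸ hq'.end_mem) hq.end_notMem
    · exact absurd (e ▸ hq.end_mem) hq'.end_notMem
    · exact hq.unique hq'
  rw [← hinj.encard_image]
  apply Set.encard_le_encard
  rintro _ ⟨q, hq, rfl⟩
  rcases hq with hq | hq
  · exact hq.choose
  · exact hq.choose.symm

/-! ### The adjacency operator of a graph of bounded degree -/

/-- The Hilbert space `ℓ²(W)` of complex square-summable functions on `W`. -/
abbrev ellTwo (W : Type*) : Type _ := lp (fun _ : W => ℂ) 2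

/-- The function `p ↦ ∑ f q`, summed over the neighbours `q` of `p`. -/
noncomputable def adjacencyFun {W : Type*} (T : SimpleGraph W) (f : W → ℂ) : W → ℂ :=
  fun p => ∑ᶠ q ∈ T.neighborSet p, f q

theorem HasDegreeBound.finite {W : Type*} {T : SimpleGraph W} {D : ℕ}
    (hT : HasDegreeBound T D) (p : W) : (T.neighborSet p).Finite :=
  Set.finite_of_encard_le_coe (hT p)

theorem HasDegreeBound.card_le {W : Type*} {T : SimpleGraph W} {D : ℕ}
    (hT : HasDegreeBound T D) (p : W) : (hT.finite p).toFinset.card ≤ D := by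
  have h := hT p
  rw [(hT.finite p).encard_eq_coe_toFinset_card] at h
  exact_mod_cast h

theorem adjacencyFun_apply {W : Type*} {T : SimpleGraph W} {D : ℕ} (hT : HasDegreeBound T D)
    (f : W → ℂ) (p : W) : adjacencyFun T f p = ∑ q ∈ (hT.finite p).toFinset, f q :=
  finsum_mem_eq_finite_toFinset_sum f (hT.finite p)

theorem sum_adjacencyFun_le {W : Type*} {T : SimpleGraph W} {D : ℕ} (hT : HasDegreeBound T D)
    (f : ellTwo W) (s : Finset W) :
    ∑ p ∈ s, ‖adjacencyFun T f p‖ ^ (2 : ENNReal).toReal ≤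
      ((D : ℝ) * ‖f‖) ^ (2 : ENNReal).toReal := by
  classical
  have h2 : (2 : ENNReal).toReal = ((2 : ℕ) : ℝ) := by simp
  simp only [h2, Real.rpow_natCast]
  have h1 : ∀ p, ‖adjacencyFun T f p‖ ^ 2 ≤ D * ∑ q ∈ (hT.finite p).toFinset, ‖f q‖ ^ 2 := by
    intro p
    rw [adjacencyFun_apply hT]
    calc ‖∑ q ∈ (hT.finite p).toFinset, f q‖ ^ 2
        ≤ (∑ q ∈ (hT.finite p).toFinset, ‖f q‖) ^ 2 := by
          gcongr
          exact norm_sum_le _ _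
      _ ≤ ((hT.finite p).toFinset.card : ℝ) * ∑ q ∈ (hT.finite p).toFinset, ‖f q‖ ^ 2 :=
          sq_sum_le_card_mul_sum_sq
      _ ≤ D * ∑ q ∈ (hT.finite p).toFinset, ‖f q‖ ^ 2 := by
          gcongr
          exact hT.card_le p
  have h3 : ∑ p ∈ s, ∑ q ∈ (hT.finite p).toFinset, ‖f q‖ ^ 2 ≤ D * ‖f‖ ^ 2 := by
    set U : Finset W := s.biUnion fun p => (hT.finite p).toFinset
    rw [Finset.sum_comm' (t' := U) (s' := fun q => s.filter fun p => T.Adj p q)]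
    · calc ∑ q ∈ U, ∑ p ∈ s.filter (fun p => T.Adj p q), ‖f q‖ ^ 2
          ≤ ∑ q ∈ U, D * ‖f q‖ ^ 2 := by
            refine Finset.sum_le_sum fun q _ => ?_
            rw [Finset.sum_const, nsmul_eq_mul]
            gcongr
            refine le_trans (Finset.card_le_card ?_) (hT.card_le q)
            intro p hp
            simpa using (Finset.mem_filter.1 hp).2.symm
        _ = D * ∑ q ∈ U, ‖f q‖ ^ 2 := by rw [Finset.mul_sum]
        _ ≤ D * ‖f‖ ^ 2 := by
            have := lp.sum_rpow_le_norm_rpow (p := 2) (by simp) f U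
            simp only [h2, Real.rpow_natCast] at this
            gcongr
    · intro p q
      simp only [Finset.mem_filter, Set.Finite.mem_toFinset, SimpleGraph.mem_neighborSet, U,
        Finset.mem_biUnion]
      constructor
      · rintro ⟨a, b⟩
        exact ⟨⟨a, b⟩, p, a, b⟩
      · rintro ⟨a, _⟩
        exact a
  calc ∑ p ∈ s, ‖adjacencyFun T f p‖ ^ 2
      ≤ ∑ p ∈ s, D * ∑ q ∈ (hT.finite p).toFinset, ‖f q‖ ^ 2 :=
        Finset.sum_le_sum fun p _ => h1 p
    _ = D * ∑ p ∈ s, ∑ q ∈ (hT.finite p).toFinset, ‖f q‖ ^ 2 := by rw [Finset.mul_sum]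
    _ ≤ D * (D * ‖f‖ ^ 2) := by gcongr
    _ = (D * ‖f‖) ^ 2 := by ring

/-- The adjacency operator of a graph of bounded degree, as a bounded operator on `ℓ²`:
`(A f) p` is the sum of `f q` over the neighbours `q` of `p`. -/
noncomputable def adjacencyOperator {W : Type*} (T : SimpleGraph W) {D : ℕ}
    (hT : HasDegreeBound T D) : ellTwo W →L[ℂ] ellTwo W :=
  LinearMap.mkContinuous
    { toFun := fun f => ⟨adjacencyFun T f, memℓp_gen' (sum_adjacencyFun_le hT f)⟩
      map_add' := fun f g => by
        ext p
        change adjacencyFun T (fun q => f q + g q) p = adjacencyFun T f p + adjacencyFun T g p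
        simp [adjacencyFun_apply hT, Finset.sum_add_distrib]
      map_smul' := fun c f => by
        ext p
        change adjacencyFun T (fun q => c * f q) p = c * adjacencyFun T f p
        simp [adjacencyFun_apply hT, Finset.mul_sum] }
    D (fun f => lp.norm_le_of_forall_sum_le (by simp) (by positivity) (sum_adjacencyFun_le hT f))

theorem adjacencyOperator_apply {W : Type*} (T : SimpleGraph W) {D : ℕ}
    (hT : HasDegreeBound T D) (f : ellTwo W) (p : W) :
    adjacencyOperator T hT f p = ∑ᶠ q ∈ T.neighborSet p, f q := rfl

theorem norm_adjacencyOperator_le {W : Type*} (T : SimpleGraph W) {D : ℕ}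
    (hT : HasDegreeBound T D) : ‖adjacencyOperator T hT‖ ≤ D :=
  LinearMap.mkContinuous_norm_le _ (by positivity) _

/-- The characteristic vector of `p` in `ℓ²(W)`. -/
noncomputable def charVec {W : Type*} (p : W) : ellTwo W :=
  open Classical in lp.single 2 p (1 : ℂ)

theorem isSelfAdjoint_adjacencyOperator {W : Type*} (T : SimpleGraph W) {D : ℕ}
    (hT : HasDegreeBound T D) : IsSelfAdjoint (adjacencyOperator T hT) := by
  classical
  have key : ∀ p, adjacencyOperator T hT (lp.single 2 p (1 : ℂ)) =
      ∑ q ∈ (hT.finite p).toFinset, lp.single 2 q (1 : ℂ) := by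
    intro p
    ext r
    rw [show adjacencyOperator T hT (lp.single 2 p (1 : ℂ)) r = _ from adjacencyFun_apply hT _ r]
    simp only [lp.coeFn_sum, Finset.sum_apply, lp.coeFn_single, Pi.single_apply]
    simp [SimpleGraph.adj_comm]
  rw [ContinuousLinearMap.isSelfAdjoint_iff']
  ext f p
  have h1 : ContinuousLinearMap.adjoint (adjacencyOperator T hT) f p =
      inner ℂ (lp.single 2 p (1 : ℂ)) (ContinuousLinearMap.adjoint (adjacencyOperator T hT) f) := by
    rw [lp.inner_single_left]; simp
  rw [h1, ContinuousLinearMap.adjoint_inner_right, key, sum_inner]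
  rw [show adjacencyOperator T hT f p = _ from adjacencyFun_apply hT _ p]
  refine Finset.sum_congr rfl fun q _ => ?_
  rw [lp.inner_single_left]; simp

/-! ### Spectral measures -/

/-- `ν` is the spectral measure of the bounded operator `A` at the vector `x`: a probability
measure on `[-D, D]` whose `n`-th moment is `⟨Aⁿ x, x⟩`. -/
structure IsSpectralMeasure {H : Type*} [NormedAddCommGroup H] [InnerProductSpace ℂ H]
    (A : H →L[ℂ] H) (x : H) (D : ℕ) (ν : Measure ℝ) : Prop where
  isProbabilityMeasure : IsProbabilityMeasure ν
  support : ν (Set.Icc (-(D : ℝ)) D)ᶜ = 0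
  moments : ∀ n : ℕ, 1 ≤ n → inner ℂ ((A ^ n) x) x = ((∫ t, t ^ n ∂ν : ℝ) : ℂ)

theorem exists_isSpectralMeasure {H : Type*} [NormedAddCommGroup H] [InnerProductSpace ℂ H]
    [CompleteSpace H] {A : H →L[ℂ] H} (hA : IsSelfAdjoint A) {x : H} (hx : ‖x‖ = 1) {D : ℕ}
    (hD : ‖A‖ ≤ D) : ∃ ν : Measure ℝ, IsSpectralMeasure A x D ν := by
  have hpos : ∀ f : C(spectrum ℝ A, ℝ), 0 ≤ f → 0 ≤ (inner ℂ (cfcHom hA f x) x).re := by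
    intro f hf
    have h : 0 ≤ cfcHom hA f := (cfcHom_nonneg_iff hA).2 hf
    exact ((ContinuousLinearMap.nonneg_iff_isPositive _).1 h).re_inner_nonneg_left x
  let L : C(spectrum ℝ A, ℝ) →ₗ[ℝ] ℝ :=
    { toFun := fun f => (inner ℂ (cfcHom hA f x) x).re
      map_add' := fun f g => by simp
      map_smul' := fun c f => by
        rw [map_smul]
        change (inner ℂ ((c : ℝ) • (cfcHom hA f x)) x).re = _
        rw [← Complex.coe_smul, inner_smul_left]
        simp }
  let Λ : CompactlySupportedContinuousMap (spectrum ℝ A) ℝ →ₚ[ℝ] ℝ :=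
    PositiveLinearMap.mk₀
      { toFun := fun f => L f.toContinuousMap
        map_add' := fun f g => L.map_add f.toContinuousMap g.toContinuousMap
        map_smul' := fun c f => L.map_smul c f.toContinuousMap }
      (fun f hf => hpos f.toContinuousMap hf)
  let ρ : Measure (spectrum ℝ A) := RealRMK.rieszMeasure Λ
  have hint : ∀ f : C(spectrum ℝ A, ℝ), ∫ t, f t ∂ρ = (inner ℂ (cfcHom hA f x) x).re := fun f =>
    RealRMK.integral_rieszMeasure Λ (CompactlySupportedContinuousMap.continuousMapEquiv f)
  have hemb : MeasurableEmbedding (Subtype.val : spectrum ℝ A → ℝ) :=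
    MeasurableEmbedding.subtype_coe (spectrum.isCompact A).measurableSet
  have hmom : ∀ n : ℕ, inner ℂ ((A ^ n) x) x = ((∫ t : spectrum ℝ A, (t : ℝ) ^ n ∂ρ : ℝ) : ℂ) := by
    intro n
    have h1 := hint (((ContinuousMap.id ℝ).restrict (spectrum ℝ A)) ^ n)
    rw [map_pow, cfcHom_id] at h1
    simp only [ContinuousMap.pow_apply, ContinuousMap.restrict_apply, ContinuousMap.id_apply] at h1
    rw [h1]
    have h2 : IsSelfAdjoint (A ^ n) := hA.pow n
    exact (Complex.conj_eq_iff_re.1 (by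
      rw [inner_conj_symm, ← ContinuousLinearMap.adjoint_inner_left,
        ContinuousLinearMap.isSelfAdjoint_iff'.1 h2])).symm
  refine ⟨ρ.map Subtype.val, ⟨⟨?_⟩, ?_, ?_⟩⟩
  · rw [hemb.map_apply, Set.preimage_univ]
    have h0 := hmom 0
    have hfin : IsFiniteMeasure ρ := by infer_instance
    simp only [pow_zero, one_apply_eq_self, inner_self_eq_norm_sq_to_K, hx,
      integral_const] at h0
    have h1 : ρ.real Set.univ = 1 := by
      simp only [smul_eq_mul, mul_one] at h0
      have h2 : ((ρ.real Set.univ : ℝ) : ℂ) = ((1 : ℝ) : ℂ) := by rw [← h0]; simp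
      exact_mod_cast h2
    rw [Measure.real] at h1
    exact (ENNReal.toReal_eq_one_iff _).1 h1
  · rw [hemb.map_apply]
    have : (Subtype.val : spectrum ℝ A → ℝ) ⁻¹' (Set.Icc (-(D : ℝ)) D)ᶜ = ∅ := by
      ext ⟨t, ht⟩
      simp only [Set.mem_preimage, Set.mem_compl_iff, Set.mem_empty_iff_false, iff_false, not_not]
      have hnt : Nontrivial H := ⟨x, 0, by rintro rfl; simp at hx⟩
      have := spectrum.norm_le_norm_of_mem ht
      rw [Real.norm_eq_abs] at this
      exact abs_le.1 (this.trans hD)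
    rw [this, measure_empty]
  · intro n _
    rw [hemb.integral_map, hmom n]

theorem IsSpectralMeasure.unique {H : Type*} [NormedAddCommGroup H] [InnerProductSpace ℂ H]
    {A : H →L[ℂ] H} {x : H} {D : ℕ} {μ ν : Measure ℝ} (hμ : IsSpectralMeasure A x D μ)
    (hν : IsSpectralMeasure A x D ν) : μ = ν := by
  have hfμ := hμ.isProbabilityMeasure
  have hfν := hν.isProbabilityMeasure
  set K : Set ℝ := Set.Icc (-(D : ℝ)) D with hK
  have hKm : MeasurableSet K := measurableSet_Icc
  have hemb : MeasurableEmbedding (Subtype.val : K → ℝ) := MeasurableEmbedding.subtype_coe hKm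
  have hrest : ∀ ρ : Measure ℝ, ρ Kᶜ = 0 → (ρ.comap (Subtype.val : K → ℝ)).map Subtype.val = ρ := by
    intro ρ hρ
    rw [hemb.map_comap, Subtype.range_coe]
    exact Measure.restrict_eq_self_of_ae_mem (by rw [ae_iff]; exact hρ)
  have hpow : ∀ n : ℕ, ∫ t, t ^ n ∂μ = ∫ t, t ^ n ∂ν := by
    intro n
    rcases Nat.eq_zero_or_pos n with rfl | hn
    · simp
    · have h := (hμ.moments n hn).symm.trans (hν.moments n hn)
      exact_mod_cast h
  have hpowK : ∀ n : ℕ, ∫ t : K, (t : ℝ) ^ n ∂(μ.comap Subtype.val) =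
      ∫ t : K, (t : ℝ) ^ n ∂(ν.comap Subtype.val) := by
    intro n
    rw [← hemb.integral_map (fun t : ℝ => t ^ n), ← hemb.integral_map (fun t : ℝ => t ^ n),
      hrest μ hμ.support, hrest ν hν.support, hpow]
  have hfin : ∀ ρ : Measure ℝ, IsProbabilityMeasure ρ →
      IsFiniteMeasure (ρ.comap (Subtype.val : K → ℝ)) := by
    intro ρ _
    refine ⟨?_⟩
    rw [hemb.comap_apply]
    exact measure_lt_top _ _
  have hμK := hfin μ hfμ
  have hνK := hfin ν hfν
  have heq : μ.comap (Subtype.val : K → ℝ) = ν.comap (Subtype.val : K → ℝ) := by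
    let S : StarSubalgebra ℝ (BoundedContinuousFunction K ℝ) :=
      { carrier := {g | ∃ p : Polynomial ℝ, ∀ t : K, g t = p.eval (t : ℝ)}
        mul_mem' := by
          rintro a b ⟨p, hp⟩ ⟨q, hq⟩
          exact ⟨p * q, fun t => by simp [hp, hq]⟩
        add_mem' := by
          rintro a b ⟨p, hp⟩ ⟨q, hq⟩
          exact ⟨p + q, fun t => by simp [hp, hq]⟩
        algebraMap_mem' := fun r => ⟨Polynomial.C r, fun t => by simp⟩
        star_mem' := by
          rintro a ⟨p, hp⟩
          exact ⟨p, fun t => by simp [hp]⟩ }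
    refine ext_of_forall_mem_subalgebra_integral_eq_of_polish (𝕜 := ℝ) (A := S) ?_ ?_
    · intro a b hab
      let X : BoundedContinuousFunction K ℝ :=
        BoundedContinuousFunction.mkOfCompact ⟨Subtype.val, continuous_subtype_val⟩
      refine ⟨fun t => (t : ℝ), ⟨X.toContinuousMap, ⟨X, ⟨Polynomial.X, fun t => by simp [X]⟩, rfl⟩,
        rfl⟩, fun h => hab (Subtype.ext h)⟩
    · rintro g ⟨p, hp⟩
      simp only [hp, Polynomial.eval_eq_sum_range]
      have hi : ∀ ρ : Measure K, IsFiniteMeasure ρ → ∀ i : ℕ,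
          Integrable (fun t : K => p.coeff i * (t : ℝ) ^ i) ρ := by
        intro ρ _ i
        exact (show Continuous fun t : K => p.coeff i * (t : ℝ) ^ i by
          fun_prop).integrable_of_hasCompactSupport (HasCompactSupport.of_compactSpace _)
      rw [integral_finsetSum _ (fun i _ => hi _ hμK i),
        integral_finsetSum _ (fun i _ => hi _ hνK i)]
      refine Finset.sum_congr rfl fun i _ => ?_
      rw [integral_const_mul, integral_const_mul, hpowK]
  rw [← hrest μ hμ.support, ← hrest ν hν.support, heq]

theorem existsUnique_isSpectralMeasure_pathTree {V : Type*} (G : SimpleGraph V) {D : ℕ}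
    (hD : HasDegreeBound G D) (o : V) :
    ∃! ν : Measure ℝ, IsSpectralMeasure (adjacencyOperator (pathTree G o) (hD.pathTree o))
      (charVec (trivialPath G o)) D ν := by
  obtain ⟨ν, hν⟩ := exists_isSpectralMeasure
    (isSelfAdjoint_adjacencyOperator (pathTree G o) (hD.pathTree o))
    (x := charVec (trivialPath G o)) (by simp [charVec, lp.norm_single])
    (norm_adjacencyOperator_le (pathTree G o) (hD.pathTree o))
  exact ⟨ν, hν, fun μ hμ => hμ.unique hν⟩

/-- The matching measure `ν_{G,o}`: the spectral measure of the adjacency operator of the path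
tree `T(G, o)` at the characteristic vector of the one-vertex path `o`. -/
noncomputable def matchingMeasure {V : Type*} (G : SimpleGraph V) {D : ℕ}
    (hD : HasDegreeBound G D) (o : V) : Measure ℝ :=
  (existsUnique_isSpectralMeasure_pathTree G hD o).choose

theorem matchingMeasure_spec {V : Type*} (G : SimpleGraph V) {D : ℕ}
    (hD : HasDegreeBound G D) (o : V) :
    IsSpectralMeasure (adjacencyOperator (pathTree G o) (hD.pathTree o))
      (charVec (trivialPath G o)) D (matchingMeasure G hD o) :=
  (existsUnique_isSpectralMeasure_pathTree G hD o).choose_spec.1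

/-! ### Matching polynomials with vertex weights and their stability. -/

section MatchingPolynomial

open scoped Classical

variable {V : Type*} (G : SimpleGraph V)

/-! Write μ(S) for the matching polynomial of the finite induced subgraph `G[S]`. By Godsil's path
tree identity, μ(S∖u)/μ(S) is a resolvent entry of the path tree of `G[S]`, and as S grows to V it
tends to the Stieltjes transform of the matching measure at u (`tendsto_matchPoly_erase_div`). At z
= θ + iε, multiplying by iε and letting ε → 0 yields the mass of θ. If this mass is a > 0 at `o`,
transitivity makes it a at every vertex.

Let c(T) be the limit of (iε)^|T| μ(S∖T)/μ(S) along an ultrafilter with S → V, then ε → 0; so c(∅) =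
1 and c({u}) = a. The Heilmann–Lieb theorem, applied with weights θ + iε(1 + s_v), survives in the
limit as a half-plane condition on the multiaffine polynomials with coefficients c(T)
(`re_limit_mul_conj_nonneg`).

That condition gives Re c({u,v}) ≥ 0, while the recursion at u makes the sum of c({u,x}) over the
neighbours x vanish; hence c vanishes on edges. Vanishing on pairs is also transitive
(`limit_pair_trans`), in the spirit of Gallai's lemma. Connectedness then kills all pairs, hence all
larger sets, and on n vertices only 1 + a ∑ s_v remains. With s_v = -1/2 and n > 2/a this is
negative, contradicting the half-plane condition. -/

/-- The multivariate matching polynomial of the subgraph of `G` induced on `S`, evaluated at the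
vertex weights `ζ`: the sum over all matchings `M` of `(-1) ^ |M|` times the product of the weights
of the vertices that `M` leaves uncovered, in the form of its vertex recursion. -/
noncomputable def matchPoly (ζ : V → ℂ) (S : Finset V) : ℂ :=
  if h : S.Nonempty then
    ζ h.choose * matchPoly ζ (S.erase h.choose) -
      ∑ x ∈ S.erase h.choose,
        if G.Adj h.choose x then matchPoly ζ ((S.erase h.choose).erase x) else 0
  else 1
termination_by S.card
decreasing_by
  · exact Finset.card_erase_lt_of_mem h.choose_spec
  · exact (Finset.card_erase_le).trans_lt (Finset.card_erase_lt_of_mem h.choose_spec)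

@[simp]
theorem matchPoly_empty (ζ : V → ℂ) : matchPoly G ζ ∅ = 1 := by
  rw [matchPoly]; simp

/-- The recursion of the matching polynomial at an arbitrary vertex. -/
theorem matchPoly_eq (ζ : V → ℂ) (S : Finset V) {u : V} (hu : u ∈ S) :
    matchPoly G ζ S = ζ u * matchPoly G ζ (S.erase u) -
      ∑ x ∈ S.erase u, if G.Adj u x then matchPoly G ζ ((S.erase u).erase x) else 0 := by
  induction S using Finset.strongInduction generalizing u with
  | H S ih =>
  have hS : S.Nonempty := ⟨u, hu⟩
  have hdef : ∃ m ∈ S, matchPoly G ζ S = ζ m * matchPoly G ζ (S.erase m) -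
      ∑ x ∈ S.erase m, if G.Adj m x then matchPoly G ζ ((S.erase m).erase x) else 0 :=
    ⟨hS.choose, hS.choose_spec, by rw [matchPoly, dif_pos hS]⟩
  obtain ⟨m, hm, hdef⟩ := hdef
  rcases eq_or_ne m u with rfl | hmu
  · exact hdef
  -- Expanding at m and then at u gives an expression that is symmetric under exchanging m and u;
  -- this is why the chosen vertex does not matter.
  have key : ∀ m u : V, m ∈ S → u ∈ S → m ≠ u → ζ m * matchPoly G ζ (S.erase m) -
      (∑ x ∈ S.erase m, if G.Adj m x then matchPoly G ζ ((S.erase m).erase x) else 0) =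
      ζ m * ζ u * matchPoly G ζ ((S.erase m).erase u)
        - ζ m * (∑ y ∈ (S.erase m).erase u,
            if G.Adj u y then matchPoly G ζ (((S.erase m).erase u).erase y) else 0)
        - (if G.Adj m u then matchPoly G ζ ((S.erase m).erase u) else 0)
        - ζ u * (∑ x ∈ (S.erase m).erase u,
            if G.Adj m x then matchPoly G ζ (((S.erase m).erase u).erase x) else 0)
        + ∑ x ∈ (S.erase m).erase u, ∑ y ∈ (S.erase m).erase u,
            if x ≠ y ∧ G.Adj m x ∧ G.Adj u y then
              matchPoly G ζ ((((S.erase m).erase u).erase x).erase y) else 0 := by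
    intro m u hm hu hmu
    have hum : u ∈ S.erase m := Finset.mem_erase.2 ⟨hmu.symm, hu⟩
    rw [← Finset.add_sum_erase _ _ hum, ih _ (Finset.erase_ssubset hm) hum]
    have h1 : ∀ x ∈ (S.erase m).erase u,
        (if G.Adj m x then matchPoly G ζ ((S.erase m).erase x) else 0) =
        ζ u * (if G.Adj m x then matchPoly G ζ (((S.erase m).erase u).erase x) else 0) -
        ∑ y ∈ (S.erase m).erase u, if x ≠ y ∧ G.Adj m x ∧ G.Adj u y then
              matchPoly G ζ ((((S.erase m).erase u).erase x).erase y) else 0 := by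
      intro x hx
      have hxu : u ≠ x := (Finset.ne_of_mem_erase hx).symm
      by_cases ha : G.Adj m x
      · simp only [ha, if_true, true_and]
        rw [ih _ ((Finset.erase_subset _ _).trans_ssubset (Finset.erase_ssubset hm))
          (Finset.mem_erase.2 ⟨hxu, hum⟩), Finset.erase_right_comm (a := x) (b := u)]
        congr 1
        rw [← Finset.add_sum_erase _ _ hx]
        simp only [ne_eq, not_true_eq_false, false_and, if_false, zero_add]
        refine Finset.sum_congr rfl fun y hy => ?_
        simp [(Finset.ne_of_mem_erase hy).symm]
      · simp [ha]
    rw [Finset.sum_congr rfl h1, Finset.sum_sub_distrib, ← Finset.mul_sum]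
    ring
  rw [hdef, key m u hm hu hmu, key u m hu hm hmu.symm, Finset.erase_right_comm (a := u) (b := m),
    Finset.sum_comm]
  simp only [G.adj_comm u m]
  have : ∀ x y : V, (((S.erase m).erase u).erase x).erase y =
      (((S.erase m).erase u).erase y).erase x := fun x y => Finset.erase_right_comm
  have h2 : (∑ y ∈ (S.erase m).erase u, ∑ x ∈ (S.erase m).erase u,
      if x ≠ y ∧ G.Adj m x ∧ G.Adj u y then
        matchPoly G ζ ((((S.erase m).erase u).erase x).erase y) else 0) =
      ∑ x ∈ (S.erase m).erase u, ∑ y ∈ (S.erase m).erase u,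
      if x ≠ y ∧ G.Adj u x ∧ G.Adj m y then
        matchPoly G ζ ((((S.erase m).erase u).erase x).erase y) else 0 := by
    refine Finset.sum_congr rfl fun x _ => Finset.sum_congr rfl fun y _ => ?_
    rw [this x y]
    refine if_congr ?_ rfl rfl
    tauto
  rw [h2]
  ring

theorem matchPoly_congr {ζ ξ : V → ℂ} {S : Finset V} (h : ∀ v ∈ S, ζ v = ξ v) :
    matchPoly G ζ S = matchPoly G ξ S := by
  induction S using Finset.strongInduction with
  | H S ih =>
  rcases S.eq_empty_or_nonempty with rfl | ⟨u, hu⟩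
  · simp
  have h1 := Finset.erase_ssubset hu
  rw [matchPoly_eq G ζ S hu, matchPoly_eq G ξ S hu, h u hu,
    ih _ h1 fun v hv => h v (Finset.mem_of_mem_erase hv)]
  congr 1
  refine Finset.sum_congr rfl fun x _ => ?_
  rw [ih _ ((Finset.erase_subset _ _).trans_ssubset h1) fun v hv =>
    h v (Finset.mem_of_mem_erase (Finset.mem_of_mem_erase hv))]

/-- The matching polynomial is affine in the weight of each vertex. -/
theorem matchPoly_update (ζ : V → ℂ) {S : Finset V} {w : V} (hw : w ∈ S) (y : ℂ) :
    matchPoly G (Function.update ζ w (ζ w + y)) S =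
      matchPoly G ζ S + y * matchPoly G ζ (S.erase w) := by
  have h : ∀ T : Finset V, w ∉ T →
      matchPoly G (Function.update ζ w (ζ w + y)) T = matchPoly G ζ T := fun T hT =>
    matchPoly_congr G fun v hv => Function.update_of_ne (by rintro rfl; exact hT hv) _ _
  rw [matchPoly_eq G _ S hw, matchPoly_eq G ζ S hw, h _ (Finset.notMem_erase w S),
    Function.update_self]
  have : ∀ x, w ∉ (S.erase w).erase x := fun x => by simp
  simp only [h _ (this _)]
  ring

/-- Taylor expansion of the matching polynomial in the weights of the vertices in `F`. -/
theorem matchPoly_add_indicator (ζ y : V → ℂ) {F S : Finset V} (hF : F ⊆ S) :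
    matchPoly G (fun v => if v ∈ F then ζ v + y v else ζ v) S =
      ∑ T ∈ F.powerset, (∏ v ∈ T, y v) * matchPoly G ζ (S \ T) := by
  induction F using Finset.induction_on generalizing S with
  | empty => simp
  | insert w F hw ih =>
    have hwS : w ∈ S := hF (Finset.mem_insert_self _ _)
    have hFS : F ⊆ S := (Finset.subset_insert _ _).trans hF
    have h1 : (fun v => if v ∈ insert w F then ζ v + y v else ζ v) =
        Function.update (fun v => if v ∈ F then ζ v + y v else ζ v) w
          ((if w ∈ F then ζ w + y w else ζ w) + y w) := by
      ext v
      rcases eq_or_ne v w with rfl | hv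
      · simp [hw]
      · simp [hv]
    rw [h1, matchPoly_update G _ hwS, ih hFS,
      ih (S := S.erase w) (Finset.subset_erase.2 ⟨hFS, hw⟩), Finset.sum_powerset_insert hw,
      Finset.mul_sum]
    congr 1
    refine Finset.sum_congr rfl fun T hT => ?_
    have hwT : w ∉ T := fun h => hw (Finset.mem_powerset.1 hT h)
    rw [Finset.prod_insert hwT, Finset.sdiff_insert, Finset.erase_sdiff_comm, mul_assoc]

/-- The Heilmann–Lieb theorem: for weights in the upper half-plane the matching polynomial does
not vanish, and the ratios at a vertex stay in the upper half-plane. -/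
theorem matchPoly_ne_zero_and_im_le {ζ : V → ℂ} (hζ : ∀ v, 0 < (ζ v).im) (S : Finset V) :
    matchPoly G ζ S ≠ 0 ∧
      ∀ u ∈ S, (ζ u).im ≤ (matchPoly G ζ S / matchPoly G ζ (S.erase u)).im := by
  induction S using Finset.strongInduction with
  | H S ih =>
  have key : ∀ u ∈ S, (ζ u).im ≤ (matchPoly G ζ S / matchPoly G ζ (S.erase u)).im := by
    intro u hu
    obtain ⟨h0, h1⟩ := ih _ (Finset.erase_ssubset hu)
    rw [matchPoly_eq G ζ S hu, sub_div, mul_div_cancel_right₀ _ h0, Complex.sub_im,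
      Finset.sum_div, Complex.im_sum]
    -- The recursion reads ratio = ζ u minus a sum of reciprocals of smaller ratios. Those lie in
    -- the upper half-plane by induction, and inversion sends it to the lower one.
    have : ∑ x ∈ S.erase u, ((if G.Adj u x then matchPoly G ζ ((S.erase u).erase x) else 0) /
        matchPoly G ζ (S.erase u)).im ≤ 0 := by
      refine Finset.sum_nonpos fun x hx => ?_
      split_ifs
      · rw [← inv_div, Complex.inv_im]
        have := (hζ x).trans_le (h1 x hx)
        exact div_nonpos_of_nonpos_of_nonneg (by linarith) (Complex.normSq_nonneg _)
      · simp
    linarith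
  refine ⟨?_, key⟩
  rcases S.eq_empty_or_nonempty with rfl | ⟨u, hu⟩
  · simp
  · intro h
    have := key u hu
    rw [h, zero_div, Complex.zero_im] at this
    exact (hζ u).not_ge this

theorem matchPoly_ne_zero {ζ : V → ℂ} (hζ : ∀ v, 0 < (ζ v).im) (S : Finset V) :
    matchPoly G ζ S ≠ 0 :=
  (matchPoly_ne_zero_and_im_le G hζ S).1

theorem im_matchPoly_erase_div_nonpos {ζ : V → ℂ} (hζ : ∀ v, 0 < (ζ v).im) {S : Finset V} {u : V}
    (hu : u ∈ S) : (matchPoly G ζ (S.erase u) / matchPoly G ζ S).im ≤ 0 := by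
  rw [← inv_div, Complex.inv_im]
  have := (hζ u).trans_le ((matchPoly_ne_zero_and_im_le G hζ S).2 u hu)
  exact div_nonpos_of_nonpos_of_nonneg (by linarith) (Complex.normSq_nonneg _)

theorem im_mul_norm_matchPoly_erase_le {ζ : V → ℂ} (hζ : ∀ v, 0 < (ζ v).im) {S : Finset V} {u : V}
    (hu : u ∈ S) : (ζ u).im * ‖matchPoly G ζ (S.erase u)‖ ≤ ‖matchPoly G ζ S‖ := by
  have h1 := (matchPoly_ne_zero_and_im_le G hζ S).2 u hu
  have h2 := h1.trans ((le_abs_self _).trans (Complex.abs_im_le_norm _))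
  rwa [norm_div, le_div_iff₀ (norm_pos_iff.2 (matchPoly_ne_zero G hζ _))] at h2

/-- Deleting the vertices of T one at a time costs a factor Im z each. This makes (iε)^|T| the right
normalisation in `matchRatio`. -/
theorem pow_mul_norm_matchPoly_sdiff_le {z : ℂ} (hz : 0 < z.im) {S T : Finset V} (hT : T ⊆ S) :
    z.im ^ T.card * ‖matchPoly G (fun _ => z) (S \ T)‖ ≤ ‖matchPoly G (fun _ => z) S‖ := by
  induction T using Finset.induction_on with
  | empty => simp
  | insert u T hu ih =>
    have huS : u ∈ S \ T := by
      simp [hu, hT (Finset.mem_insert_self u T)]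
    refine le_trans ?_ (ih ((Finset.subset_insert _ _).trans hT))
    rw [Finset.card_insert_of_notMem hu, Finset.sdiff_insert, pow_succ, mul_assoc]
    gcongr
    exact im_mul_norm_matchPoly_erase_le G (ζ := fun _ => z) (fun _ => hz) huS

theorem matchPoly_map (φ : G ≃g G) (z : ℂ) (S : Finset V) :
    matchPoly G (fun _ => z) (S.map φ.toEquiv.toEmbedding) = matchPoly G (fun _ => z) S := by
  induction S using Finset.strongInduction with
  | H S ih =>
  rcases S.eq_empty_or_nonempty with rfl | ⟨u, hu⟩
  · simp
  have h1 := Finset.erase_ssubset hu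
  have h2 : ∀ (S : Finset V) (x : V), (S.map φ.toEquiv.toEmbedding).erase (φ x) =
      (S.erase x).map φ.toEquiv.toEmbedding := fun S x => by
    rw [Finset.map_erase]; rfl
  rw [matchPoly_eq G _ _ hu, matchPoly_eq G _ _ (Finset.mem_map_of_mem φ.toEquiv.toEmbedding hu)]
  change z * matchPoly G _ ((S.map φ.toEquiv.toEmbedding).erase (φ u)) - ∑ x ∈
    ((S.map φ.toEquiv.toEmbedding).erase (φ u)), (if G.Adj (φ u) x then matchPoly G _
      (((S.map φ.toEquiv.toEmbedding).erase (φ u)).erase x) else 0) = _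
  rw [h2, ih _ h1, Finset.sum_map]
  congr 1
  refine Finset.sum_congr rfl fun x _ => ?_
  change (if G.Adj (φ u) (φ x) then matchPoly G _
      (((S.erase u).map φ.toEquiv.toEmbedding).erase (φ x)) else 0) = _
  rw [h2, ih _ ((Finset.erase_subset _ _).trans_ssubset h1)]
  simp [φ.map_adj_iff]

end MatchingPolynomial

/-! ### Limits of normalised ratios and the contradiction from equal positive masses. -/

section Concentration

open scoped Classical
open Filter Topology Complex ComplexConjugate

variable {V : Type*} (G : SimpleGraph V)

/-- The ratio of the matching polynomials of `G[S \ T]` and `G[S]` at `θ + iε`, normalised by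
`(iε) ^ |T|`, where `i = (ε, S)`. -/
noncomputable def matchRatio (θ : ℝ) (T : Finset V) (i : ℝ × Finset V) : ℂ :=
  (I * i.1) ^ T.card * matchPoly G (fun _ => θ + I * i.1) (i.2 \ T) /
    matchPoly G (fun _ => θ + I * i.1) i.2

theorem norm_matchRatio_le_one (θ : ℝ) {T : Finset V} {i : ℝ × Finset V} (hi : 0 < i.1)
    (hT : T ⊆ i.2) : ‖matchRatio G θ T i‖ ≤ 1 := by
  have hz : 0 < ((θ : ℂ) + I * i.1).im := by simpa using hi
  have h := pow_mul_norm_matchPoly_sdiff_le G hz hT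
  rw [matchRatio, norm_div, norm_mul, norm_pow, norm_mul, norm_I, one_mul, norm_real,
    Real.norm_of_nonneg hi.le, div_le_one (norm_pos_iff.2 (matchPoly_ne_zero G (fun _ => hz) _))]
  simpa using h

theorem matchRatio_empty (θ : ℝ) {i : ℝ × Finset V} (hi : 0 < i.1) : matchRatio G θ ∅ i = 1 := by
  have hz : 0 < ((θ : ℂ) + I * i.1).im := by simpa using hi
  simp [matchRatio, div_self (matchPoly_ne_zero G (fun _ => hz) _)]

theorem norm_matchRatio_insert_le (θ : ℝ) {T : Finset V} {u : V} {i : ℝ × Finset V} (hi : 0 < i.1)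
    (hT : insert u T ⊆ i.2) : ‖matchRatio G θ (insert u T) i‖ ≤ ‖matchRatio G θ T i‖ := by
  by_cases hu : u ∈ T
  · rw [Finset.insert_eq_of_mem hu]
  have hz : 0 < ((θ : ℂ) + I * i.1).im := by simpa using hi
  have h := im_mul_norm_matchPoly_erase_le G (ζ := fun _ => (θ : ℂ) + I * i.1) (fun _ => hz)
    (S := i.2 \ T) (u := u) (by simp [hu, hT (Finset.mem_insert_self _ _)])
  rw [matchRatio, matchRatio, norm_div, norm_div, norm_mul, norm_mul,
    Finset.card_insert_of_notMem hu, Finset.sdiff_insert, pow_succ, norm_mul, mul_assoc]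
  gcongr
  simpa [abs_of_pos hi] using h

/-- The recursion at `u`, written with normalised ratios. -/
theorem sum_matchRatio_neighbors (θ : ℝ) {u : V} {B : Finset V} (hB : ∀ x, x ∈ B ↔ G.Adj u x)
    {i : ℝ × Finset V} (hi : 0 < i.1) (hu : u ∈ i.2) (hBi : B ⊆ i.2) :
    ∑ x ∈ B, matchRatio G θ {u, x} i =
      (I * i.1) * (θ + I * i.1) * matchRatio G θ {u} i - (I * i.1) ^ 2 := by
  have hz : 0 < ((θ : ℂ) + I * i.1).im := by simpa using hi
  have h0 := matchPoly_ne_zero G (ζ := fun _ => (θ : ℂ) + I * i.1) (fun _ => hz) i.2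
  have h1 := matchPoly_eq G (fun _ => (θ : ℂ) + I * i.1) i.2 hu
  have h2 : ∑ x ∈ B, matchRatio G θ {u, x} i = (I * i.1) ^ 2 *
      (∑ x ∈ i.2.erase u, if G.Adj u x then
        matchPoly G (fun _ => (θ : ℂ) + I * i.1) ((i.2.erase u).erase x) else 0) /
      matchPoly G (fun _ => (θ : ℂ) + I * i.1) i.2 := by
    rw [← Finset.sum_filter, Finset.mul_sum, Finset.sum_div]
    have h3 : (i.2.erase u).filter (G.Adj u) = B := by
      ext x
      simp only [Finset.mem_filter, Finset.mem_erase, hB]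
      exact ⟨fun h => h.2, fun h => ⟨⟨h.ne', hBi ((hB x).2 h)⟩, h⟩⟩
    rw [h3]
    refine Finset.sum_congr rfl fun x hx => ?_
    have hux : u ≠ x := ((hB x).1 hx).ne
    rw [matchRatio, Finset.card_pair hux]
    congr 3
    ext y
    simp only [Finset.mem_sdiff, Finset.mem_insert, Finset.mem_singleton, Finset.mem_erase]
    tauto
  rw [h2, matchRatio, Finset.card_singleton, Finset.sdiff_singleton_eq_erase,
    eq_sub_of_add_eq' (sub_eq_iff_eq_add.1 h1.symm).symm]
  field_simp

variable {G} {θ : ℝ} {U : Ultrafilter (ℝ × Finset V)} {c : Finset V → ℂ}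

theorem eventually_pos_of_tendsto_fst (hε : Tendsto Prod.fst (U : Filter (ℝ × Finset V)) (𝓝[>] 0)) :
    ∀ᶠ i in (U : Filter (ℝ × Finset V)), 0 < i.1 :=
  hε.eventually self_mem_nhdsWithin

/-- The ratios eventually lie in the closed unit disc, so compactness gives a limit; one ultrafilter
serves all T at once. -/
theorem exists_tendsto_matchRatio
    (hε : Tendsto Prod.fst (U : Filter (ℝ × Finset V)) (𝓝[>] 0))
    (hS : Tendsto Prod.snd (U : Filter (ℝ × Finset V)) atTop) (T : Finset V) :
    ∃ c : ℂ, Tendsto (matchRatio G θ T) U (𝓝 c) := by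
  have h : ∀ᶠ i in (U : Filter (ℝ × Finset V)), matchRatio G θ T i ∈ Metric.closedBall (0 : ℂ) 1 := by
    filter_upwards [eventually_pos_of_tendsto_fst hε, hS.eventually_ge_atTop T] with i h1 h2
    simpa using norm_matchRatio_le_one G θ h1 h2
  obtain ⟨c, -, hc⟩ := (isCompact_closedBall (0 : ℂ) 1).ultrafilter_le_nhds
    (U.map (matchRatio G θ T)) (le_principal_iff.2 h)
  exact ⟨c, hc⟩

theorem limit_empty (hε : Tendsto Prod.fst (U : Filter (ℝ × Finset V)) (𝓝[>] 0))
    (hc : ∀ T, Tendsto (matchRatio G θ T) U (𝓝 (c T))) : c ∅ = 1 := by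
  refine tendsto_nhds_unique (hc ∅) (tendsto_const_nhds.congr' ?_)
  filter_upwards [eventually_pos_of_tendsto_fst hε] with i hi
  exact (matchRatio_empty G θ hi).symm

/-- Inserting a vertex never increases the norm of a normalised ratio, so zeros of c propagate to
supersets. -/
theorem limit_insert_eq_zero (hε : Tendsto Prod.fst (U : Filter (ℝ × Finset V)) (𝓝[>] 0))
    (hS : Tendsto Prod.snd (U : Filter (ℝ × Finset V)) atTop)
    (hc : ∀ T, Tendsto (matchRatio G θ T) U (𝓝 (c T))) {T : Finset V} (hT : c T = 0) (u : V) :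
    c (insert u T) = 0 := by
  have h := le_of_tendsto_of_tendsto (hc (insert u T)).norm (hc T).norm (by
    filter_upwards [eventually_pos_of_tendsto_fst hε, hS.eventually_ge_atTop (insert u T)]
      with i h1 h2
    exact norm_matchRatio_insert_le G θ h1 h2)
  rw [hT, norm_zero] at h
  exact norm_le_zero_iff.1 h

/-- Stability of the matching polynomial, passed to the limit. -/
theorem re_limit_mul_conj_nonneg (hε : Tendsto Prod.fst (U : Filter (ℝ × Finset V)) (𝓝[>] 0))
    (hS : Tendsto Prod.snd (U : Filter (ℝ × Finset V)) atTop)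
    (hc : ∀ T, Tendsto (matchRatio G θ T) U (𝓝 (c T))) {F : Finset V} {u : V} (hu : u ∉ F)
    (s : V → ℂ) (hs : ∀ v, -1 < (s v).re) :
    0 ≤ ((∑ T ∈ F.powerset, (∏ v ∈ T, s v) * c (insert u T)) *
      conj (∑ T ∈ F.powerset, (∏ v ∈ T, s v) * c T)).re := by
  refine ge_of_tendsto (x := (U : Filter (ℝ × Finset V))) (f := fun i => ((∑ T ∈ F.powerset, (∏ v ∈ T, s v) *
      matchRatio G θ (insert u T) i) *
      conj (∑ T ∈ F.powerset, (∏ v ∈ T, s v) * matchRatio G θ T i)).re) ?_ ?_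
  · refine (continuous_re.tendsto _).comp (Tendsto.mul ?_ ((continuous_conj.tendsto _).comp ?_))
    all_goals exact tendsto_finsetSum _ fun T _ => (hc _).const_mul _
  filter_upwards [eventually_pos_of_tendsto_fst hε, hS.eventually_ge_atTop (insert u F)] with i hi hF
  set z : ℂ := θ + I * i.1 with hzdef
  -- On F the weight becomes θ + iε(1 + s v), whose imaginary part ε(1 + Re s v) is positive exactly
  -- when Re s v > -1.
  set y : V → ℂ := fun v => I * i.1 * s v with hy
  set ζ : V → ℂ := fun v => if v ∈ F then z + y v else z with hζdef
  have hz : 0 < z.im := by simpa [hzdef] using hi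
  have hζ : ∀ v, 0 < (ζ v).im := by
    intro v
    by_cases hv : v ∈ F
    · have : (ζ v).im = i.1 * (1 + (s v).re) := by simp [hζdef, hv, hzdef, hy]; ring
      rw [this]
      exact mul_pos hi (by linarith [hs v])
    · simpa [hζdef, hv] using hz
  have huS : u ∈ i.2 := hF (Finset.mem_insert_self _ _)
  have hFS : F ⊆ i.2 := (Finset.subset_insert _ _).trans hF
  have h1 := matchPoly_ne_zero G hζ i.2
  have hprod : ∀ T : Finset V, ∏ v ∈ T, y v = (I * i.1) ^ T.card * ∏ v ∈ T, s v := by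
    intro T
    simp only [hy, Finset.prod_mul_distrib, Finset.prod_const, mul_pow]
  have hden : ∑ T ∈ F.powerset, (∏ v ∈ T, s v) * matchRatio G θ T i =
      matchPoly G ζ i.2 / matchPoly G (fun _ => z) i.2 := by
    rw [hζdef, matchPoly_add_indicator G (fun _ => z) y hFS, Finset.sum_div]
    refine Finset.sum_congr rfl fun T _ => ?_
    rw [matchRatio, hprod]
    ring
  have hnum : ∑ T ∈ F.powerset, (∏ v ∈ T, s v) * matchRatio G θ (insert u T) i =
      I * i.1 * (matchPoly G ζ (i.2.erase u) / matchPoly G ζ i.2) *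
        (matchPoly G ζ i.2 / matchPoly G (fun _ => z) i.2) := by
    rw [mul_assoc, div_mul_div_cancel₀ h1, hζdef,
      matchPoly_add_indicator G (fun _ => z) y (S := i.2.erase u) (Finset.subset_erase.2 ⟨hFS, hu⟩),
      Finset.sum_div, Finset.mul_sum]
    refine Finset.sum_congr rfl fun T hT => ?_
    have huT : u ∉ T := fun h => hu (Finset.mem_powerset.1 hT h)
    rw [matchRatio, hprod, Finset.card_insert_of_notMem huT, Finset.sdiff_insert,
      Finset.erase_sdiff_comm]
    ring
  -- The product is iε · r · |q|², where r is the ratio at u for the perturbed weights and q the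
  -- quotient in `hden`; Re(iεr) = -ε Im r ≥ 0.
  rw [hnum, hden, mul_assoc, mul_conj, re_mul_ofReal]
  refine mul_nonneg ?_ (normSq_nonneg _)
  have := im_matchPoly_erase_div_nonpos G hζ huS
  simp only [mul_re, mul_im, I_re, I_im, ofReal_re, ofReal_im]
  nlinarith

theorem re_limit_pair_nonneg (hε : Tendsto Prod.fst (U : Filter (ℝ × Finset V)) (𝓝[>] 0))
    (hS : Tendsto Prod.snd (U : Filter (ℝ × Finset V)) atTop)
    (hc : ∀ T, Tendsto (matchRatio G θ T) U (𝓝 (c T))) {u v : V} (huv : u ≠ v) {s : ℂ}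
    (hs : -1 < s.re) :
    0 ≤ ((c {u} + s * c {u, v}) * conj (1 + s * c {v})).re := by
  have h := re_limit_mul_conj_nonneg hε hS hc (F := insert v ∅) (u := u) (by simpa using huv)
    (fun _ => s) (fun _ => hs)
  rw [Finset.sum_powerset_insert (by simp), Finset.sum_powerset_insert (by simp)] at h
  simpa [limit_empty hε hc] using h

theorem re_limit_triple_nonneg (hε : Tendsto Prod.fst (U : Filter (ℝ × Finset V)) (𝓝[>] 0))
    (hS : Tendsto Prod.snd (U : Filter (ℝ × Finset V)) atTop)
    (hc : ∀ T, Tendsto (matchRatio G θ T) U (𝓝 (c T))) {u v w : V} (huv : u ≠ v) (huw : u ≠ w)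
    (hvw : v ≠ w) {s t : ℂ} (hs : -1 < s.re) (ht : -1 < t.re) :
    0 ≤ ((c {u} + t * c {u, w} + (s * c {u, v} + s * t * c {u, v, w})) *
      conj (1 + t * c {w} + (s * c {v} + s * t * c {v, w}))).re := by
  have h := re_limit_mul_conj_nonneg hε hS hc (F := insert v (insert w ∅)) (u := u)
    (by simp [huv, huw]) (fun x => if x = v then s else t) (fun x => by
      split_ifs <;> assumption)
  rw [Finset.sum_powerset_insert (by simpa using hvw), Finset.sum_powerset_insert (by simp),
    Finset.sum_powerset_insert (by simp), Finset.sum_powerset_insert (by simpa using hvw),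
    Finset.sum_powerset_insert (by simp), Finset.sum_powerset_insert (by simp)] at h
  simpa [limit_empty hε hc, hvw, hvw.symm] using h

variable {a : ℝ}

theorem re_limit_pair_eq_nonneg (hε : Tendsto Prod.fst (U : Filter (ℝ × Finset V)) (𝓝[>] 0))
    (hS : Tendsto Prod.snd (U : Filter (ℝ × Finset V)) atTop)
    (hc : ∀ T, Tendsto (matchRatio G θ T) U (𝓝 (c T))) (ha : 0 < a) (hca : ∀ u, c {u} = a)
    {u v : V} (huv : u ≠ v) : 0 ≤ (c {u, v}).re := by
  by_contra! h
  -- With ρ = Re c({u,v}) < 0 and s = 1 - a/ρ, the first factor has real part a + sρ = ρ < 0 while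
  -- the second is the positive real 1 + sa.
  have h1 := re_limit_pair_nonneg hε hS hc huv (s := ((1 + a / -(c {u, v}).re : ℝ) : ℂ)) (by
    rw [ofReal_re]
    have : 0 < a / -(c {u, v}).re := div_pos ha (by linarith)
    linarith)
  have h2 : 0 < 1 + (1 + a / -(c {u, v}).re) * a := by
    have : 0 < a / -(c {u, v}).re := div_pos ha (by linarith)
    positivity
  rw [hca, hca] at h1
  have h3 : conj (1 + ((1 + a / -(c {u, v}).re : ℝ) : ℂ) * (a : ℂ)) =
      ((1 + (1 + a / -(c {u, v}).re) * a : ℝ) : ℂ) := by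
    rw [← ofReal_mul, ← ofReal_one, ← ofReal_add, conj_ofReal]
  rw [h3, re_mul_ofReal, add_re, re_ofReal_mul, ofReal_re] at h1
  have h4 := nonneg_of_mul_nonneg_left h1 h2
  have h5 : a / -(c {u, v}).re * (c {u, v}).re = -a := by
    have := h.ne
    field_simp
  nlinarith

theorem limit_pair_eq_zero_of_re (hε : Tendsto Prod.fst (U : Filter (ℝ × Finset V)) (𝓝[>] 0))
    (hS : Tendsto Prod.snd (U : Filter (ℝ × Finset V)) atTop)
    (hc : ∀ T, Tendsto (matchRatio G θ T) U (𝓝 (c T))) (hca : ∀ u, c {u} = a)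
    {u v : V} (huv : u ≠ v) (hre : (c {u, v}).re = 0) : c {u, v} = 0 := by
  refine Complex.ext hre ?_
  by_contra him
  rw [zero_im] at him
  -- If c({u,v}) = im and s = ik, the product has real part a - km; this k makes it -1.
  have h1 := re_limit_pair_nonneg hε hS hc huv (s := ((a + 1) / (c {u, v}).im : ℝ) * I) (by simp)
  rw [hca, hca] at h1
  have h2 : (a + 1) / (c {u, v}).im * (c {u, v}).im = a + 1 := div_mul_cancel₀ _ him
  simp only [map_add, map_mul, map_one, conj_ofReal, conj_I, mul_re, add_re, mul_im, add_im,
    one_re, one_im, ofReal_re, ofReal_im, I_re, I_im, hre, neg_re, neg_im] at h1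
  ring_nf at h1 h2
  linarith

/-- In the recursion at u the right-hand side carries factors of ε and tends to 0. The limits
c({u,x}) over the finitely many neighbours thus sum to 0, and their real parts are nonnegative. -/
theorem limit_pair_eq_zero_of_adj {D : ℕ} (hD : HasDegreeBound G D)
    (hε : Tendsto Prod.fst (U : Filter (ℝ × Finset V)) (𝓝[>] 0))
    (hS : Tendsto Prod.snd (U : Filter (ℝ × Finset V)) atTop)
    (hc : ∀ T, Tendsto (matchRatio G θ T) U (𝓝 (c T))) (ha : 0 < a) (hca : ∀ u, c {u} = a)
    {u v : V} (huv : G.Adj u v) : c {u, v} = 0 := by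
  set B := (hD.finite u).toFinset with hB
  have hBmem : ∀ x, x ∈ B ↔ G.Adj u x := fun x => by simp [hB]
  have hε0 : Tendsto (fun i : ℝ × Finset V => I * (i.1 : ℂ)) U (𝓝 0) := by
    have h := ((continuous_ofReal.tendsto 0).comp
      (hε.mono_right nhdsWithin_le_nhds)).const_mul I
    simpa using h
  have h1 : Tendsto (fun i => ∑ x ∈ B, matchRatio G θ {u, x} i) U (𝓝 (∑ x ∈ B, c {u, x})) :=
    tendsto_finsetSum _ fun x _ => hc _
  have h2 : Tendsto (fun i => ∑ x ∈ B, matchRatio G θ {u, x} i) U (𝓝 0) := by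
    have h := ((hε0.mul (hε0.const_add (θ : ℂ))).mul (hc {u})).sub (hε0.pow 2)
    simp only [zero_mul, ne_eq, OfNat.ofNat_ne_zero, not_false_eq_true, zero_pow, sub_zero] at h
    refine h.congr' ?_
    filter_upwards [eventually_pos_of_tendsto_fst hε, hS.eventually_ge_atTop (insert u B)]
      with i hi hBi
    exact (sum_matchRatio_neighbors G θ hBmem hi (hBi (Finset.mem_insert_self _ _))
      ((Finset.subset_insert _ _).trans hBi)).symm
  have h3 := congrArg re (tendsto_nhds_unique h1 h2)
  rw [re_sum, zero_re, Finset.sum_eq_zero_iff_of_nonneg fun x hx =>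
    re_limit_pair_eq_nonneg hε hS hc ha hca ((hBmem x).1 hx).ne] at h3
  exact limit_pair_eq_zero_of_re hε hS hc hca huv.ne (h3 v ((hBmem v).2 huv))

/-- The triple limit vanishes too, so in the stability inequality for u against {v, w} the weight s
of v occurs only in the second factor. Taking s purely imaginary and large breaks the inequality
unless Re c({u,w}) = 0. -/
theorem limit_pair_trans (hε : Tendsto Prod.fst (U : Filter (ℝ × Finset V)) (𝓝[>] 0))
    (hS : Tendsto Prod.snd (U : Filter (ℝ × Finset V)) atTop)
    (hc : ∀ T, Tendsto (matchRatio G θ T) U (𝓝 (c T))) (ha : 0 < a) (hca : ∀ u, c {u} = a)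
    {u v w : V} (huv : u ≠ v) (huw : u ≠ w) (hvw : v ≠ w) (h1 : c {u, v} = 0)
    (h2 : c {v, w} = 0) : c {u, w} = 0 := by
  refine limit_pair_eq_zero_of_re hε hS hc hca huw ?_
  have h0 := re_limit_pair_eq_nonneg hε hS hc ha hca huw
  by_contra hne
  have hpos : 0 < (c {u, w}).re := lt_of_le_of_ne h0 (Ne.symm hne)
  have h3 : c {u, v, w} = 0 := limit_insert_eq_zero hε hS hc h2 u
  set r := (c {u, w}).re
  set m := (c {u, w}).im
  -- For t = i and s = ik the real part is (a - m) + ra(1 + k); this k turns it into (a - m) - |a -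
  -- m| - 1 < 0.
  have h4 := re_limit_triple_nonneg hε hS hc huv huw hvw
    (s := ((-((|a - m| + 1) / (r * a)) - 1 : ℝ) : ℂ) * I) (t := I) (by rw [re_ofReal_mul]; simp) (by simp)
  rw [h1, h2, h3, hca, hca, hca] at h4
  simp only [mul_zero, add_zero, map_add, map_mul, map_one, conj_ofReal, conj_I, mul_re, add_re,
    mul_im, add_im, one_re, one_im, ofReal_re, ofReal_im, I_re, I_im, neg_re, neg_im] at h4
  change 0 ≤ (a + (0 * r - 1 * m)) * _ - (0 + (0 * m + 1 * r)) * _ at h4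
  have h5 : (|a - m| + 1) / (r * a) * (r * a) = |a - m| + 1 :=
    div_mul_cancel₀ _ (mul_pos hpos ha).ne'
  have h6 := le_abs_self (a - m)
  ring_nf at h4 h5 h6
  linarith

theorem limit_pair_eq_zero {D : ℕ} (hD : HasDegreeBound G D) (hG : G.Connected)
    (hε : Tendsto Prod.fst (U : Filter (ℝ × Finset V)) (𝓝[>] 0))
    (hS : Tendsto Prod.snd (U : Filter (ℝ × Finset V)) atTop)
    (hc : ∀ T, Tendsto (matchRatio G θ T) U (𝓝 (c T))) (ha : 0 < a) (hca : ∀ u, c {u} = a)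
    {u v : V} (huv : u ≠ v) : c {u, v} = 0 := by
  obtain ⟨p⟩ := hG.preconnected u v
  induction p with
  | nil => exact absurd rfl huv
  | @cons u x v h p ih =>
    have h1 := limit_pair_eq_zero_of_adj hD hε hS hc ha hca h
    rcases eq_or_ne x v with rfl | hxv
    · exact h1
    · exact limit_pair_trans hε hS hc ha hca h.ne huv hxv h1 (ih hxv)

/-- In an infinite connected graph the vertices cannot all carry the same positive mass. -/
theorem false_of_limit_singleton_pos [Infinite V] {D : ℕ} (hD : HasDegreeBound G D)
    (hG : G.Connected) (hε : Tendsto Prod.fst (U : Filter (ℝ × Finset V)) (𝓝[>] 0))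
    (hS : Tendsto Prod.snd (U : Filter (ℝ × Finset V)) atTop)
    (hc : ∀ T, Tendsto (matchRatio G θ T) U (𝓝 (c T))) (ha : 0 < a) (hca : ∀ u, c {u} = a) :
    False := by
  have hzero : ∀ T : Finset V, 1 < T.card → c T = 0 := by
    intro T hT
    obtain ⟨u, hu, v, hv, huv⟩ := Finset.one_lt_card.1 hT
    have h0 := limit_pair_eq_zero hD hG hε hS hc ha hca huv
    have h1 : ∀ R : Finset V, c (R ∪ {u, v}) = 0 := by
      intro R
      induction R using Finset.induction_on with
      | empty => simpa using h0
      | insert w R _ ih =>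
        rw [Finset.insert_union]
        exact limit_insert_eq_zero hε hS hc ih w
    have h2 := h1 T
    rwa [Finset.union_eq_left.2 (by simp [Finset.insert_subset_iff, hu, hv])] at h2
  -- On n vertices with s = -1/2 the stability inequality reduces to a(1 - na/2) ≥ 0, which n > 2/a
  -- violates.
  obtain ⟨n, hn⟩ := exists_nat_gt (2 / a)
  obtain ⟨F, hF⟩ := Infinite.exists_subset_card_eq V n
  obtain ⟨u, hu⟩ := Infinite.exists_notMem_finset F
  have hsum : ∀ (d : Finset V → ℂ) (s : ℂ), (∀ T : Finset V, 1 < T.card → d T = 0) →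
      ∑ T ∈ F.powerset, (∏ v ∈ T, s) * d T = d ∅ + s * ∑ v ∈ F, d {v} := by
    intro d s hd
    rw [Finset.sum_powerset]
    rcases n.eq_zero_or_pos with rfl | hnpos
    · rw [hF, Finset.card_eq_zero.1 hF]; simp
    · rw [hF, ← Finset.sum_subset (Finset.range_subset_range.2 (show 2 ≤ n + 1 by omega))]
      · rw [Finset.sum_range_succ, Finset.sum_range_one, Finset.powersetCard_zero,
          Finset.powersetCard_one]
        simp [Finset.mul_sum]
      · intro k _ hk
        refine Finset.sum_eq_zero fun T hT => ?_
        rw [hd T (by rw [(Finset.mem_powersetCard.1 hT).2]; simpa using hk), mul_zero]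
  have h := re_limit_mul_conj_nonneg hε hS hc hu (fun _ => ((-(1 / 2) : ℝ) : ℂ))
    (fun _ => by rw [ofReal_re]; norm_num)
  have hnum : ∑ T ∈ F.powerset, (∏ v ∈ T, ((-(1 / 2) : ℝ) : ℂ)) * c (insert u T) = a := by
    have hins : ∀ T ∈ F.powerset, T ≠ ∅ → (∏ v ∈ T, ((-(1 / 2) : ℝ) : ℂ)) * c (insert u T) = 0 := by
      intro T hT hne
      have huT : u ∉ T := fun h => hu (Finset.mem_powerset.1 hT h)
      rw [hzero _ (by
        rw [Finset.card_insert_of_notMem huT]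
        have := Finset.card_pos.2 (Finset.nonempty_iff_ne_empty.2 hne)
        omega), mul_zero]
    rw [Finset.sum_eq_single_of_mem ∅ (Finset.empty_mem_powerset F) hins]
    simp [hca]
  rw [hnum, hsum c _ hzero, limit_empty hε hc] at h
  simp only [hca, Finset.sum_const, hF, nsmul_eq_mul] at h
  have hcast : (1 + ((-(1 / 2) : ℝ) : ℂ) * ((n : ℂ) * (a : ℂ))) =
      ((1 + -(1 / 2) * (n * a) : ℝ) : ℂ) := by push_cast; ring
  rw [hcast, conj_ofReal, ← ofReal_mul, ofReal_re] at h
  rw [div_lt_iff₀ ha] at hn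
  have := nonneg_of_mul_nonneg_right h ha
  linarith

end Concentration

/-! ### Spectral measures and their Stieltjes transforms. -/

section SpectralMeasure

open Polynomial ComplexConjugate

variable {H : Type*} [NormedAddCommGroup H] [InnerProductSpace ℂ H]
  {A : H →L[ℂ] H} {x : H} {D : ℕ} {ν : Measure ℝ}

theorem IsSpectralMeasure.integrable (hν : IsSpectralMeasure A x D ν) {E : Type*}
    [NormedAddCommGroup E] [SecondCountableTopology E] {f : ℝ → E} (hf : Continuous f) :
    Integrable f ν := by
  have := hν.isProbabilityMeasure
  have h : ν.restrict (Set.Icc (-(D : ℝ)) D) = ν :=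
    Measure.restrict_eq_self_of_ae_mem (by rw [ae_iff]; exact hν.support)
  rw [← h]
  exact hf.continuousOn.integrableOn_compact isCompact_Icc

theorem IsSpectralMeasure.inner_aeval (hν : IsSpectralMeasure A x D ν) (hx : ‖x‖ = 1)
    (p : ℝ[X]) : inner ℂ (aeval A p x) x = ((∫ t, p.eval t ∂ν : ℝ) : ℂ) := by
  have := hν.isProbabilityMeasure
  have hmom : ∀ n : ℕ, inner ℂ ((A ^ n) x) x = ((∫ t, t ^ n ∂ν : ℝ) : ℂ) := by
    intro n
    rcases n.eq_zero_or_pos with rfl | hn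
    -- The zeroth moment is not part of `IsSpectralMeasure`; both sides are 1 because x is a unit
    -- vector and ν a probability measure.
    · simp [hx, inner_self_eq_norm_sq_to_K]
    · exact hν.moments n hn
  simp only [aeval_eq_sum_range, eval_eq_sum_range, sum_apply,
    smul_apply, sum_inner]
  rw [integral_finsetSum _ fun i _ => hν.integrable (by fun_prop), Complex.ofReal_sum]
  refine Finset.sum_congr rfl fun i _ => ?_
  rw [integral_const_mul, Complex.ofReal_mul, ← hmom, ← Complex.coe_smul, inner_smul_left,
    Complex.conj_ofReal]

theorem Complex.sub_ofReal_ne_zero {z : ℂ} (hz : 0 < z.im) (t : ℝ) : z - t ≠ 0 := fun h => by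
  have := congrArg Complex.im h
  simp at this
  exact hz.ne' this

theorem Complex.norm_inv_sub_ofReal_le {z : ℂ} (hz : 0 < z.im) (t : ℝ) :
    ‖(z - t)⁻¹‖ ≤ z.im⁻¹ := by
  rw [norm_inv]
  gcongr
  have := Complex.abs_im_le_norm (z - t)
  rw [Complex.sub_im, Complex.ofReal_im, sub_zero] at this
  exact (le_abs_self _).trans this

/-- `iε` times the resolvent function at `θ + iε` recovers the mass of `θ`. -/
theorem IsSpectralMeasure.tendsto_mul_integral_inv (hν : IsSpectralMeasure A x D ν) (θ : ℝ) :
    Filter.Tendsto (fun ε : ℝ => Complex.I * ε * ∫ t : ℝ, (θ + Complex.I * ε - t : ℂ)⁻¹ ∂ν)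
      (nhdsWithin 0 (Set.Ioi 0)) (nhds ((ν.real {θ} : ℝ) : ℂ)) := by
  have := hν.isProbabilityMeasure
  have h1 : ((ν.real {θ} : ℝ) : ℂ) = ∫ t : ℝ, Set.indicator {θ} (fun _ => (1 : ℂ)) t ∂ν := by
    rw [integral_indicator (measurableSet_singleton θ)]
    simp [Measure.real]
  simp only [← integral_const_mul]
  rw [h1]
  -- The integrand iε/(θ + iε - t) is bounded by 1 in norm and tends pointwise to the indicator of
  -- θ.
  refine tendsto_integral_filter_of_dominated_convergence (fun _ => 1) ?_ ?_
    (integrable_const _) ?_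
  · filter_upwards [self_mem_nhdsWithin] with ε hε
    have hz : 0 < ((θ : ℂ) + Complex.I * ε).im := by simpa using hε
    exact (continuous_const.mul (Continuous.inv₀ (by fun_prop)
      (Complex.sub_ofReal_ne_zero hz))).aestronglyMeasurable
  · filter_upwards [self_mem_nhdsWithin] with ε hε
    have hz : 0 < ((θ : ℂ) + Complex.I * ε).im := by simpa using hε
    have hε' : 0 < ε := hε
    refine Filter.Eventually.of_forall fun t => ?_
    have h := Complex.norm_inv_sub_ofReal_le hz t
    rw [norm_mul, norm_mul, Complex.norm_I, one_mul, Complex.norm_real,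
      Real.norm_of_nonneg hε'.le]
    calc ε * _ ≤ ε * ε⁻¹ := by
          gcongr
          simpa using h
      _ = 1 := mul_inv_cancel₀ hε'.ne'
  · refine Filter.Eventually.of_forall fun t => ?_
    by_cases ht : t = θ
    · subst ht
      simp only [Set.mem_singleton_iff, Set.indicator_of_mem]
      refine tendsto_const_nhds.congr' ?_
      filter_upwards [self_mem_nhdsWithin] with ε hε
      have : (ε : ℂ) ≠ 0 := by exact_mod_cast (ne_of_gt hε)
      rw [add_sub_cancel_left, mul_inv_cancel₀ (mul_ne_zero Complex.I_ne_zero this)]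
    · rw [Set.indicator_of_notMem (by simpa using ht)]
      have hne : (θ : ℂ) + Complex.I * (0 : ℝ) - t ≠ 0 := by
        simp only [Complex.ofReal_zero, mul_zero, add_zero]
        rw [sub_ne_zero]
        exact_mod_cast Ne.symm ht
      have hc : ContinuousAt (fun ε : ℝ => Complex.I * ε * (θ + Complex.I * ε - t : ℂ)⁻¹) 0 :=
        ContinuousAt.mul (by fun_prop) (ContinuousAt.inv₀ (by fun_prop) hne)
      have := hc.tendsto.mono_left (nhdsWithin_le_nhds (s := Set.Ioi 0))
      simpa using this

variable [CompleteSpace H]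

theorem isSelfAdjoint_aeval_real (hA : IsSelfAdjoint A) (p : ℝ[X]) : IsSelfAdjoint (aeval A p) := by
  rw [aeval_eq_sum_range]
  exact isSelfAdjoint_sum _ fun i _ => (IsSelfAdjoint.all _).smul (hA.pow i)

theorem inner_aeval_left (hA : IsSelfAdjoint A) (p : ℝ[X]) (y w : H) :
    inner ℂ (aeval A p y) w = inner ℂ y (aeval A p w) := by
  rw [← ContinuousLinearMap.adjoint_inner_right,
    ContinuousLinearMap.isSelfAdjoint_iff'.1 (isSelfAdjoint_aeval_real hA p)]

/-- The square of the norm is ∫ p² dν, so only values of p on the support matter. -/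
theorem IsSpectralMeasure.norm_aeval_le (hν : IsSpectralMeasure A x D ν) (hA : IsSelfAdjoint A)
    (hx : ‖x‖ = 1) {p : ℝ[X]} {δ : ℝ} (hδ : 0 ≤ δ)
    (hp : ∀ t ∈ Set.Icc (-(D : ℝ)) D, |p.eval t| ≤ δ) : ‖aeval A p x‖ ≤ δ := by
  have := hν.isProbabilityMeasure
  have h1 : inner ℂ (aeval A p x) (aeval A p x) = ((∫ t, (p ^ 2).eval t ∂ν : ℝ) : ℂ) := by
    rw [← hν.inner_aeval hx, ← inner_aeval_left hA, sq, map_mul]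
    rfl
  rw [inner_self_eq_norm_sq_to_K] at h1
  have h2 : ‖aeval A p x‖ ^ 2 = ∫ t, (p ^ 2).eval t ∂ν := by
    rw [← Complex.ofReal_inj, Complex.ofReal_pow]
    exact h1
  have h3 : ∫ t, (p ^ 2).eval t ∂ν ≤ ∫ _, δ ^ 2 ∂ν := by
    refine integral_mono_ae (hν.integrable (by fun_prop)) (integrable_const _) ?_
    have : ∀ᵐ t ∂ν, t ∈ Set.Icc (-(D : ℝ)) D := by rw [ae_iff]; exact hν.support
    filter_upwards [this] with t ht
    rw [eval_pow]
    exact sq_le_sq' (by linarith [abs_le.1 (hp t ht)]) (abs_le.1 (hp t ht)).2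
  simp only [integral_const, probReal_univ, one_smul] at h3
  exact abs_le_of_sq_le_sq' (h2 ▸ h3) hδ |>.2

/-- Comparison of the resolvent function of a spectral measure with an approximate solution `g`
of `(z - A) g = x`, tested on a polynomial. -/
theorem IsSpectralMeasure.norm_inner_sub_integral_le (hν : IsSpectralMeasure A x D ν)
    (hA : IsSelfAdjoint A) (hx : ‖x‖ = 1) {z : ℂ} (hz : 0 < z.im) {p : ℝ[X]} {δ : ℝ} (hδ : 0 ≤ δ)
    (hp : ∀ t ∈ Set.Icc (-(D : ℝ)) D, |(Complex.normSq (z - t)) * p.eval t - 1| ≤ δ) {g : H}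
    (hg : inner ℂ (z • aeval A p x - A (aeval A p x)) (z • g - A g) =
      inner ℂ (z • aeval A p x - A (aeval A p x)) x) :
    ‖inner ℂ x g - ∫ t : ℝ, (z - t)⁻¹ ∂ν‖ ≤ δ * ‖g‖ + δ * z.im⁻¹ := by
  have := hν.isProbabilityMeasure
  have hsymm : ∀ y w : H, inner ℂ (A y) w = inner ℂ y (A w) := fun y w => by
    simpa using inner_aeval_left hA X y w
  -- Here b(t) = |z - t|² on the real line and b(A) = (z - A)*(z - A). Since p approximates 1/b,
  -- ⟨b(A)p(A)x, g⟩ is close to ⟨x, g⟩. By `hg` it equals ∫ (z̄ - t) p(t) dν, which is close to ∫ (z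
  -- - t)⁻¹ dν.
  set b : ℝ[X] := X ^ 2 - C (2 * z.re) * X + C (Complex.normSq z) with hb
  have hbt : ∀ t, b.eval t = Complex.normSq (z - t) := fun t => by
    simp [hb, Complex.normSq_apply]; ring
  set W := aeval A p x with hW
  have h1 : inner ℂ (aeval A (b * p) x) g = inner ℂ (z • W - A W) x := by
    rw [← hg, map_mul]
    change inner ℂ (aeval A b W) g = _
    have : aeval A b W = A (A W) - (2 * z.re : ℝ) • A W + (Complex.normSq z) • W := by
      simp only [hb, map_add, map_sub, map_mul, aeval_X, aeval_C,
        add_apply, sub_apply, sq,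
        mul_apply_eq_comp]
      simp [Algebra.algebraMap_eq_smul_one, mul_smul, two_smul]
    rw [this, inner_add_left, inner_sub_left, ← Complex.coe_smul, ← Complex.coe_smul,
      inner_smul_left, inner_smul_left, inner_sub_left, inner_sub_right, inner_sub_right,
      inner_smul_left, inner_smul_left, inner_smul_right, inner_smul_right, hsymm, hsymm W,
      hsymm W, Complex.conj_ofReal, Complex.conj_ofReal, ← Complex.mul_conj z]
    have h2 : ((2 * z.re : ℝ) : ℂ) = z + conj z := by
      rw [Complex.add_conj]
    rw [h2]
    ring
  have h2 : inner ℂ (z • W - A W) x = ∫ t : ℝ, (conj z - t) * p.eval t ∂ν := by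
    have e1 : inner ℂ (A W) x = ((∫ t, (X * p).eval t ∂ν : ℝ) : ℂ) := by
      rw [← hν.inner_aeval hx, map_mul, aeval_X]; rfl
    rw [inner_sub_left, inner_smul_left, e1, hν.inner_aeval hx, ← integral_complex_ofReal,
      ← integral_complex_ofReal, ← integral_const_mul, ← integral_sub]
    · congr 1
      ext t
      simp
      ring
    · exact hν.integrable (by fun_prop)
    · exact hν.integrable (by fun_prop)
  have h3 : inner ℂ x g = (∫ t : ℝ, (conj z - t) * p.eval t ∂ν) -
      inner ℂ (aeval A (b * p - 1) x) g := by
    rw [← h2, ← h1, map_sub, map_one, sub_apply, inner_sub_left]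
    simp
  have h4 : ‖inner ℂ (aeval A (b * p - 1) x) g‖ ≤ δ * ‖g‖ := by
    refine (norm_inner_le_norm _ _).trans ?_
    gcongr
    refine hν.norm_aeval_le hA hx hδ fun t ht => ?_
    simpa [hbt] using hp t ht
  have hcont : Continuous fun t : ℝ => (z - t)⁻¹ :=
    Continuous.inv₀ (by fun_prop) (Complex.sub_ofReal_ne_zero hz)
  have h5 : ‖(∫ t : ℝ, (conj z - t) * p.eval t ∂ν) - ∫ t : ℝ, (z - t)⁻¹ ∂ν‖ ≤ δ * z.im⁻¹ := by
    rw [← integral_sub (hν.integrable (by fun_prop)) (hν.integrable hcont)]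
    have h6 : ∀ᵐ t : ℝ ∂ν, ‖(conj z - t) * p.eval t - (z - t)⁻¹‖ ≤ δ * z.im⁻¹ := by
      have : ∀ᵐ t ∂ν, t ∈ Set.Icc (-(D : ℝ)) D := by rw [ae_iff]; exact hν.support
      filter_upwards [this] with t ht
      have e : (conj z - t) * ((p.eval t : ℝ) : ℂ) - (z - t)⁻¹ =
          ((Complex.normSq (z - t) * p.eval t - 1 : ℝ) : ℂ) * (z - t)⁻¹ := by
        have := Complex.sub_ofReal_ne_zero hz t
        push_cast
        rw [← Complex.mul_conj, map_sub, Complex.conj_ofReal]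
        field_simp
      rw [e, norm_mul, Complex.norm_real]
      exact mul_le_mul (hp t ht) (Complex.norm_inv_sub_ofReal_le hz t) (norm_nonneg _) hδ
    simpa using norm_integral_le_of_norm_le_const h6
  rw [h3]
  calc _ = ‖((∫ t : ℝ, (conj z - t) * p.eval t ∂ν) - ∫ t : ℝ, (z - t)⁻¹ ∂ν) -
      inner ℂ (aeval A (b * p - 1) x) g‖ := by congr 1; ring
    _ ≤ _ := (norm_sub_le _ _).trans (by linarith)

theorem exists_polynomial_normSq_mul_near_one (D : ℕ) {z : ℂ} (hz : 0 < z.im) {δ : ℝ}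
    (hδ : 0 < δ) :
    ∃ p : ℝ[X], ∀ t ∈ Set.Icc (-(D : ℝ)) D, |(Complex.normSq (z - t)) * p.eval t - 1| ≤ δ := by
  have hpos : ∀ t : ℝ, 0 < Complex.normSq (z - t) := fun t =>
    Complex.normSq_pos.2 (Complex.sub_ofReal_ne_zero hz t)
  have hc : Continuous fun t : ℝ => Complex.normSq (z - t) :=
    Complex.continuous_normSq.comp (by fun_prop)
  obtain ⟨B, hB⟩ := isCompact_Icc.exists_bound_of_continuousOn
    (s := Set.Icc (-(D : ℝ)) D) hc.continuousOn
  have hB0 : 0 < |B| + 1 := by positivity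
  obtain ⟨p, hp⟩ := exists_polynomial_near_of_continuousOn (-(D : ℝ)) D
    (fun t => (Complex.normSq (z - t))⁻¹) (hc.inv₀ fun t => (hpos t).ne').continuousOn
    (δ / (|B| + 1)) (by positivity)
  refine ⟨p, fun t ht => ?_⟩
  have e : (Complex.normSq (z - t)) * p.eval t - 1 =
      Complex.normSq (z - t) * (p.eval t - (Complex.normSq (z - t))⁻¹) := by
    rw [mul_sub, mul_inv_cancel₀ (hpos t).ne']
  have h1 : Complex.normSq (z - t) ≤ |B| + 1 := by
    have := hB t ht
    rw [Real.norm_of_nonneg (hpos t).le] at this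
    linarith [le_abs_self B]
  rw [e, abs_mul, abs_of_pos (hpos t)]
  calc _ ≤ (|B| + 1) * (δ / (|B| + 1)) := by
        gcongr
        exact (hp t ht).le
    _ = δ := by field_simp

end SpectralMeasure

/-! ### Resolvents of finite path trees and their convergence. -/

section TruncatedResolvent

open scoped Classical
open Filter Topology

theorem lp_inner_congr_right {W : Type*} {f g g' : ellTwo W} (h : ∀ p, f p ≠ 0 → g p = g' p) :
    inner ℂ f g = inner ℂ f g' := by
  rw [lp.inner_eq_tsum, lp.inner_eq_tsum]
  refine tsum_congr fun p => ?_
  by_cases hp : f p = 0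
  · simp [hp]
  · rw [h p hp]

theorem lp_inner_congr_left {W : Type*} {f f' g : ellTwo W} (h : ∀ p, g p ≠ 0 → f p = f' p) :
    inner ℂ f g = inner ℂ f' g := by
  rw [← inner_conj_symm, lp_inner_congr_right h, inner_conj_symm]

theorem finite_support_adjacencyOperator {W : Type*} (T : SimpleGraph W) {D : ℕ}
    (hT : HasDegreeBound T D) {f : ellTwo W} (hf : {p | f p ≠ 0}.Finite) :
    {p | adjacencyOperator T hT f p ≠ 0}.Finite := by
  refine (hf.biUnion fun p _ => hT.finite p).subset fun q hq => ?_
  rw [Set.mem_ofPred_eq, adjacencyOperator_apply] at hq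
  obtain ⟨p, hp, hp'⟩ := exists_ne_zero_of_finsum_mem_ne_zero hq
  exact Set.mem_biUnion (x := p) hp' (show T.Adj p q from (show T.Adj q p from hp).symm)

theorem finite_support_sum {W ι : Type*} (s : Finset ι) (f : ι → ellTwo W)
    (hf : ∀ i ∈ s, {p | f i p ≠ 0}.Finite) : {p | (∑ i ∈ s, f i) p ≠ 0}.Finite := by
  refine (s.finite_toSet.biUnion hf).subset fun p hp => ?_
  rw [Set.mem_ofPred_eq, lp.coeFn_sum, Finset.sum_apply] at hp
  obtain ⟨i, hi, h⟩ := Finset.exists_ne_zero_of_sum_ne_zero hp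
  exact Set.mem_biUnion hi h

theorem charVec_apply {W : Type*} (p q : W) : (charVec p : ellTwo W) q = if q = p then 1 else 0 := by
  simp [charVec, Pi.single_apply]

theorem norm_charVec {W : Type*} (p : W) : ‖(charVec p : ellTwo W)‖ = 1 := by
  simp [charVec, lp.norm_single]

theorem inner_charVec_left {W : Type*} (p : W) (f : ellTwo W) : inner ℂ (charVec p) f = f p := by
  rw [charVec, lp.inner_single_left]; simp

/-- Finite propagation: this is why the test vectors are polynomials in A, as one finite S then
contains every path they see. -/
theorem finite_support_aeval_charVec {W : Type*} (T : SimpleGraph W) {D : ℕ}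
    (hT : HasDegreeBound T D) (o : W) (p : Polynomial ℝ) :
    {q | Polynomial.aeval (adjacencyOperator T hT) p (charVec o) q ≠ 0}.Finite := by
  have hpow : ∀ n : ℕ, {q | (adjacencyOperator T hT ^ n) (charVec o) q ≠ 0}.Finite := by
    intro n
    induction n with
    | zero =>
      refine (Set.finite_singleton o).subset fun q hq => ?_
      by_contra h
      exact hq (by rw [pow_zero]; exact (charVec_apply o q).trans (if_neg h))
    | succ n ih =>
      rw [pow_succ']
      exact finite_support_adjacencyOperator T hT ih
  rw [Polynomial.aeval_eq_sum_range, sum_apply]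
  refine finite_support_sum _ _ fun i _ => (hpow i).subset fun q hq => ?_
  contrapose! hq
  simp only [Set.mem_ofPred_eq, not_not] at hq ⊢
  rw [smul_apply, lp.coeFn_smul, Pi.smul_apply, hq, smul_zero]

variable {V : Type*} {G : SimpleGraph V} {o : V}

/-- The vertices of a path that starts at `o`. -/
noncomputable def PathsFrom.verts (P : PathsFrom G o) : Finset V :=
  (P.2 : G.Walk o P.1).support.toFinset

theorem PathsFrom.mem_verts {P : PathsFrom G o} {v : V} :
    v ∈ P.verts ↔ v ∈ (P.2 : G.Walk o P.1).support := List.mem_toFinset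

theorem PathsFrom.verts_trivialPath : (trivialPath G o).verts = {o} := by
  ext v; simp [PathsFrom.mem_verts, trivialPath, SimpleGraph.Path.nil]

theorem ExtendsByEdge.verts_eq {P Q : PathsFrom G o} (h : ExtendsByEdge P Q) :
    Q.verts = insert Q.1 P.verts := by
  obtain ⟨h, e⟩ := h
  ext v
  simp [PathsFrom.mem_verts, e, SimpleGraph.Walk.support_concat, or_comm]

theorem exists_extendsByEdge {P : PathsFrom G o} {x : V} (h : G.Adj P.1 x) (hx : x ∉ P.verts) :
    ∃ Q : PathsFrom G o, ExtendsByEdge P Q ∧ Q.1 = x := by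
  rw [PathsFrom.mem_verts] at hx
  exact ⟨⟨x, (P.2 : G.Walk o P.1).concat h,
    (SimpleGraph.Walk.concat_isPath_iff h).2 ⟨P.2.2, hx⟩⟩, ⟨h, rfl⟩, rfl⟩

theorem eq_trivialPath_or_exists_extendsByEdge (P : PathsFrom G o) :
    P = trivialPath G o ∨ ∃ Q : PathsFrom G o, ExtendsByEdge Q P := by
  obtain ⟨v, p, hp⟩ := P
  induction p using SimpleGraph.Walk.concatRec with
  | Hnil => exact Or.inl rfl
  | Hconcat p h _ =>
    exact Or.inr ⟨⟨_, p, ((SimpleGraph.Walk.concat_isPath_iff h).1 hp).1⟩, h, rfl⟩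

theorem not_extendsByEdge_trivialPath (Q : PathsFrom G o) :
    ¬ ExtendsByEdge Q (trivialPath G o) := fun h =>
  h.end_notMem (SimpleGraph.Walk.start_mem_support _)

theorem finite_setOf_verts_subset (S : Finset V) : {P : PathsFrom G o | P.verts ⊆ S}.Finite := by
  have h1 : (Set.range fun l : {l : List S // l.Nodup} => l.1.map Subtype.val).Finite :=
    Set.finite_range _
  refine Set.Finite.of_finite_image (f := fun P : PathsFrom G o => (P.2 : G.Walk o P.1).support)
    (h1.subset ?_) ?_
  · rintro _ ⟨P, hP, rfl⟩
    have hP' : ∀ v ∈ (P.2 : G.Walk o P.1).support, v ∈ S := fun v hv =>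
      hP (PathsFrom.mem_verts.2 hv)
    lift (P.2 : G.Walk o P.1).support to List S using hP' with l hl
    have := P.2.2.support_nodup
    rw [← hl] at this
    exact ⟨⟨l, this.of_map _⟩, rfl⟩
  · rintro ⟨v, p⟩ - ⟨w, q⟩ - h
    have hvw : v = w := by
      have h1 := (p : G.Walk o v).getLast_support
      have h2 := (q : G.Walk o w).getLast_support
      simp only at h
      rw [← h1, ← h2]
      congr 1
    subst hvw
    exact congrArg (Sigma.mk v) (Subtype.ext (SimpleGraph.Walk.ext_support h))

theorem memℓp_of_finite_support {W : Type*} {f : W → ℂ} (hf : {p | f p ≠ 0}.Finite) :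
    Memℓp f 2 :=
  (memℓp_zero hf).of_exponent_ge (zero_le)

/-- The resolvent vector of the path tree of the finite graph `G[S]`, as a vector on the path
tree of `G`. -/
noncomputable def truncatedResolvent (G : SimpleGraph V) (o : V) (z : ℂ) (S : Finset V) :
    ellTwo (PathsFrom G o) :=
  ⟨fun P => if P.verts ⊆ S then
      matchPoly G (fun _ => z) (S \ P.verts) / matchPoly G (fun _ => z) S else 0,
    memℓp_of_finite_support ((finite_setOf_verts_subset S).subset fun P hP => by
      by_contra h
      exact hP (if_neg h))⟩

theorem truncatedResolvent_apply (z : ℂ) (S : Finset V) (P : PathsFrom G o) :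
    truncatedResolvent G o z S P = if P.verts ⊆ S then
      matchPoly G (fun _ => z) (S \ P.verts) / matchPoly G (fun _ => z) S else 0 := rfl

/-- After multiplication by μ(S) this is the matching recursion: at `o` in S for the trivial path,
otherwise at the end of P in S minus the vertices of its parent. Children of P inside S correspond
to neighbours of its end in S off P; children leaving S contribute 0. -/
theorem truncatedResolvent_equation {D : ℕ} (hD : HasDegreeBound G D) {z : ℂ} (hz : 0 < z.im)
    {S : Finset V} {P : PathsFrom G o} (hP : P.verts ⊆ S) :
    (z • truncatedResolvent G o z S - adjacencyOperator (pathTree G o) (hD.pathTree o)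
      (truncatedResolvent G o z S)) P = charVec (trivialPath G o) P := by
  set g := truncatedResolvent G o z S with hg
  set M := matchPoly G (fun _ => z) with hM
  have h0 : M S ≠ 0 := matchPoly_ne_zero G (fun _ => hz) S
  have hend : P.1 ∈ P.verts := PathsFrom.mem_verts.2 (SimpleGraph.Walk.end_mem_support _)
  have hA : adjacencyOperator (pathTree G o) (hD.pathTree o) g P =
      ∑ q ∈ ((hD.pathTree o).finite P).toFinset, g q := adjacencyFun_apply (hD.pathTree o) _ P
  rw [lp.coeFn_sub, Pi.sub_apply, lp.coeFn_smul, Pi.smul_apply, smul_eq_mul, hA, charVec_apply,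
    ← Finset.sum_filter_add_sum_filter_not _ (fun q => ExtendsByEdge P q)]
  have hchild : ∑ q ∈ ((hD.pathTree o).finite P).toFinset with ExtendsByEdge P q, g q =
      (∑ x ∈ S \ P.verts, if G.Adj P.1 x then M ((S \ P.verts).erase x) else 0) / M S := by
    rw [← Finset.sum_filter, Finset.sum_div]
    symm
    rw [← Finset.sum_filter_of_ne (p := fun q : PathsFrom G o => q.1 ∈ S)]
    · symm
      refine Finset.sum_nbij (fun q => q.1) ?_ ?_ ?_ ?_
      · intro q hq
        simp only [Finset.mem_filter, Set.Finite.mem_toFinset] at hq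
        obtain ⟨⟨-, hq⟩, hqS⟩ := hq
        simp only [Finset.mem_filter, Finset.mem_sdiff]
        exact ⟨⟨hqS, fun h => hq.end_notMem (PathsFrom.mem_verts.1 h)⟩, hq.choose⟩
      · intro q hq q' hq' e
        simp only [Finset.coe_filter, Set.mem_ofPred_eq, Finset.mem_filter] at hq hq'
        exact hq.1.2.eq_of_end_eq hq'.1.2 e
      · intro x hx
        simp only [Finset.coe_filter, Set.mem_ofPred_eq, Finset.mem_sdiff] at hx
        obtain ⟨Q, hQ, rfl⟩ := exists_extendsByEdge hx.2 hx.1.2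
        refine ⟨Q, ?_, rfl⟩
        simp only [Finset.coe_filter, Set.mem_ofPred_eq, Finset.mem_filter, Set.Finite.mem_toFinset]
        exact ⟨⟨Or.inl hQ, hQ⟩, hx.1.1⟩
      · intro q hq
        simp only [Finset.mem_filter] at hq
        rw [hg, truncatedResolvent_apply, hq.1.2.verts_eq,
          if_pos (Finset.insert_subset hq.2 hP), Finset.sdiff_insert]
    · intro q hq hne
      simp only [Finset.mem_filter] at hq
      by_contra hqS
      refine hne (if_neg fun h => hqS (h ?_))
      rw [hq.2.verts_eq]
      exact Finset.mem_insert_self _ _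
  have hparent : ∀ Q, ExtendsByEdge Q P →
      ∑ q ∈ ((hD.pathTree o).finite P).toFinset with ¬ ExtendsByEdge P q, g q = g Q := by
    intro Q hQ
    have hnot : ¬ ExtendsByEdge P Q := fun h =>
      h.end_notMem hQ.end_mem
    refine Finset.sum_eq_single_of_mem Q ?_ ?_
    · simp only [Finset.mem_filter, Set.Finite.mem_toFinset]
      exact ⟨Or.inr hQ, hnot⟩
    · intro q hq hne
      simp only [Finset.mem_filter, Set.Finite.mem_toFinset] at hq
      exact absurd ((hq.1.resolve_left hq.2).unique hQ) hne
  have hgP : g P = M (S \ P.verts) / M S := if_pos hP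
  rw [hchild, hgP]
  rcases eq_trivialPath_or_exists_extendsByEdge P with rfl | ⟨Q, hQ⟩
  · have hempty : ∑ q ∈ ((hD.pathTree o).finite (trivialPath G o)).toFinset with
        ¬ ExtendsByEdge (trivialPath G o) q, g q = 0 := by
      refine Finset.sum_eq_zero fun q hq => ?_
      simp only [Finset.mem_filter, Set.Finite.mem_toFinset] at hq
      exact absurd (hq.1.resolve_left hq.2) (not_extendsByEdge_trivialPath q)
    rw [hempty, if_pos rfl, PathsFrom.verts_trivialPath, Finset.sdiff_singleton_eq_erase]
    have hrec := matchPoly_eq G (fun _ => z) S (u := o) (hP (by simp [PathsFrom.verts_trivialPath]))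
    change M S = _ at hrec
    change _ - ((∑ x ∈ S.erase o, if G.Adj o x then M ((S.erase o).erase x) else 0) / M S + 0) = _
    field_simp
    linear_combination -hrec
  · have hne : P ≠ trivialPath G o := by
      rintro rfl
      exact not_extendsByEdge_trivialPath Q hQ
    have hPQ := hQ.verts_eq
    have hQS : Q.verts ⊆ S := (hPQ ▸ Finset.subset_insert _ _ : Q.verts ⊆ P.verts).trans hP
    have hgQ : g Q = M (S \ Q.verts) / M S := if_pos hQS
    have hmem : P.1 ∈ S \ Q.verts := Finset.mem_sdiff.2
      ⟨hP hend, fun h => hQ.end_notMem (PathsFrom.mem_verts.1 h)⟩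
    have hrec := matchPoly_eq G (fun _ => z) (S \ Q.verts) hmem
    rw [← Finset.sdiff_insert, ← hPQ] at hrec
    change M (S \ Q.verts) = z * M (S \ P.verts) - _ at hrec
    rw [hparent Q hQ, hgQ, if_neg hne]
    field_simp
    linear_combination -hrec

/-- The vector g is supported where the resolvent equation holds, so ⟨(z - A)g, g⟩ = ⟨χ, g⟩. As A is
symmetric, imaginary parts give Im z · ‖g‖² ≤ ‖g‖, uniformly in S. -/
theorem norm_truncatedResolvent_le {D : ℕ} (hD : HasDegreeBound G D) {z : ℂ} (hz : 0 < z.im)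
    (S : Finset V) : ‖truncatedResolvent G o z S‖ ≤ z.im⁻¹ := by
  set g := truncatedResolvent G o z S with hg
  set A := adjacencyOperator (pathTree G o) (hD.pathTree o)
  have h1 : inner ℂ (z • g - A g) g = inner ℂ (charVec (trivialPath G o)) g := by
    refine lp_inner_congr_left fun P hP => truncatedResolvent_equation hD hz ?_
    by_contra h
    exact hP (if_neg h)
  have hself : (inner ℂ (A g) g).im = 0 := by
    have h2 := inner_aeval_left (isSelfAdjoint_adjacencyOperator (pathTree G o) (hD.pathTree o))
      Polynomial.X g g
    rw [Polynomial.aeval_X] at h2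
    rw [← Complex.conj_eq_iff_im, inner_conj_symm]
    exact h2.symm
  rw [inner_sub_left, inner_smul_left, inner_self_eq_norm_sq_to_K] at h1
  have h3 := congrArg Complex.im h1
  have h4 : ((starRingEnd ℂ) z * ((‖g‖ : ℂ)) ^ 2).im = -(z.im * ‖g‖ ^ 2) := by
    rw [← Complex.ofReal_pow, Complex.im_mul_ofReal, Complex.conj_im]; ring
  rw [Complex.sub_im, hself, sub_zero] at h3
  have h5 : z.im * ‖g‖ ^ 2 ≤ ‖g‖ := by
    have h6 := (Complex.abs_im_le_norm _).trans
      (norm_inner_le_norm (𝕜 := ℂ) (charVec (trivialPath G o)) g)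
    rw [norm_charVec, one_mul, ← h3] at h6
    have h7 := (neg_le_abs _).trans h6
    have h8 : -((starRingEnd ℂ) z * ((‖g‖ : ℂ)) ^ 2).im ≤ ‖g‖ := h7
    rwa [h4, neg_neg] at h8
  rcases (norm_nonneg g).eq_or_lt with h | h
  · rw [← h]; positivity
  · rw [le_inv_comm₀ h hz, inv_eq_one_div, le_div_iff₀ h]
    nlinarith

/-- In the upper half-plane the ratios of matching polynomials of finite induced subgraphs converge
to the resolvent function of the path tree. -/
theorem tendsto_matchPoly_erase_div {D : ℕ} (hD : HasDegreeBound G D) {z : ℂ} (hz : 0 < z.im) :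
    Tendsto (fun S : Finset V => matchPoly G (fun _ => z) (S.erase o) / matchPoly G (fun _ => z) S)
      atTop (𝓝 (∫ t : ℝ, (z - t)⁻¹ ∂(matchingMeasure G hD o))) := by
  rw [Metric.tendsto_atTop]
  intro η hη
  -- The total error is at most 2δ / Im z = η/2.
  set δ := η * z.im / 4 with hδ
  have hδ0 : 0 < δ := by positivity
  obtain ⟨p, hp⟩ := exists_polynomial_normSq_mul_near_one D hz hδ0
  set A := adjacencyOperator (pathTree G o) (hD.pathTree o) with hA
  set W := Polynomial.aeval A p (charVec (trivialPath G o)) with hW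
  have hWf : {q | W q ≠ 0}.Finite := finite_support_aeval_charVec _ _ _ p
  have hYf : {q | (z • W - A W) q ≠ 0}.Finite := by
    refine (hWf.union (finite_support_adjacencyOperator _ (hD.pathTree o) hWf)).subset
      fun q hq => ?_
    by_contra h
    simp only [Set.mem_union, Set.mem_ofPred_eq, not_or, not_not] at h
    refine hq ?_
    rw [lp.coeFn_sub, Pi.sub_apply, lp.coeFn_smul, Pi.smul_apply, h.1, smul_zero, zero_sub,
      neg_eq_zero]
    exact h.2
  -- Such S contains every path in the support of (z - A)W, so the truncated equation holds wherever
  -- it is tested.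
  refine ⟨insert o (hYf.toFinset.biUnion PathsFrom.verts), fun S hS => ?_⟩
  have hoS : o ∈ S := hS (Finset.mem_insert_self _ _)
  have hgo : inner ℂ (charVec (trivialPath G o)) (truncatedResolvent G o z S) =
      matchPoly G (fun _ => z) (S.erase o) / matchPoly G (fun _ => z) S := by
    rw [inner_charVec_left, truncatedResolvent_apply, PathsFrom.verts_trivialPath,
      if_pos (Finset.singleton_subset_iff.2 hoS), Finset.sdiff_singleton_eq_erase]
  have h := (matchingMeasure_spec G hD o).norm_inner_sub_integral_le
    (isSelfAdjoint_adjacencyOperator _ _) (norm_charVec _) hz hδ0.le hp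
    (g := truncatedResolvent G o z S) (lp_inner_congr_right fun P hP =>
      truncatedResolvent_equation hD hz fun v hv => hS (Finset.mem_insert_of_mem
        (Finset.mem_biUnion.2 ⟨P, hYf.mem_toFinset.2 hP, hv⟩)))
  rw [hgo] at h
  rw [dist_eq_norm]
  refine h.trans_lt ?_
  have h1 : δ * ‖truncatedResolvent G o z S‖ ≤ δ * z.im⁻¹ := by
    gcongr
    exact norm_truncatedResolvent_le hD hz S
  have h2 : δ * z.im⁻¹ = η / 4 := by rw [hδ]; field_simp
  linarith

end TruncatedResolvent

/-! ### Iterated limits, automorphism invariance and the conclusion. -/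

section Main

open scoped Classical
open Filter Topology

/-- Iterated limits along `atTop` and then `ε → 0⁺` are limits along a single filter. -/
theorem exists_ultrafilter_iterated_limit (α : Type*) :
    ∃ U : Ultrafilter (ℝ × Finset α),
      Tendsto Prod.fst (U : Filter (ℝ × Finset α)) (𝓝[>] 0) ∧
      Tendsto Prod.snd (U : Filter (ℝ × Finset α)) atTop ∧
      ∀ (h : ℝ × Finset α → ℂ) (L : ℝ → ℂ) (a : ℂ),
        (∀ ε > 0, Tendsto (fun S => h (ε, S)) atTop (𝓝 (L ε))) →
        Tendsto L (𝓝[>] 0) (𝓝 a) → Tendsto h U (𝓝 a) := by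
  set F : Filter (ℝ × Finset α) :=
    (𝓝[>] (0 : ℝ)).bind fun ε => (atTop : Filter (Finset α)).map (Prod.mk ε) with hF
  have hmem : ∀ s : Set (ℝ × Finset α), s ∈ F ↔
      ∀ᶠ ε in 𝓝[>] (0 : ℝ), ∀ᶠ S in (atTop : Filter (Finset α)), (ε, S) ∈ s := fun s => by
    rw [hF, Filter.mem_bind']; rfl
  have hne : F.NeBot := by
    refine ⟨fun h => ?_⟩
    have h0 : (∅ : Set (ℝ × Finset α)) ∈ F := by rw [h]; exact mem_bot
    rw [hmem] at h0
    simp only [Set.mem_empty_iff_false, eventually_const] at h0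
  refine ⟨Ultrafilter.of F, ?_, ?_, ?_⟩
  · refine Tendsto.mono_left (fun s hs => ?_) (Ultrafilter.of_le F)
    rw [mem_map, hmem]
    exact (show ∀ᶠ ε in 𝓝[>] (0 : ℝ), ε ∈ s from hs).mono fun ε h => Eventually.of_forall fun _ => h
  · refine Tendsto.mono_left (fun s hs => ?_) (Ultrafilter.of_le F)
    rw [mem_map, hmem]
    exact Eventually.of_forall fun ε => hs
  · intro h L a h1 h2
    refine Tendsto.mono_left ?_ (Ultrafilter.of_le F)
    rw [(nhds_basis_opens a).tendsto_right_iff]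
    rintro s ⟨ha, hs⟩
    rw [Filter.Eventually, hmem]
    filter_upwards [h2.eventually (hs.mem_nhds ha), self_mem_nhdsWithin] with ε h3 h4
    exact (h1 ε h4).eventually (hs.mem_nhds h3)

/-- An automorphism permutes the finite vertex sets cofinally and preserves their matching
polynomials, so both sides are limits of the same ratios. -/
theorem matchingMeasure_integral_inv_eq {V : Type*} {G : SimpleGraph V} {D : ℕ}
    (hD : HasDegreeBound G D) (φ : G ≃g G) (u : V) {z : ℂ} (hz : 0 < z.im) :
    ∫ t : ℝ, (z - t)⁻¹ ∂(matchingMeasure G hD (φ u)) =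
      ∫ t : ℝ, (z - t)⁻¹ ∂(matchingMeasure G hD u) := by
  have hmap : Tendsto (fun S : Finset V => S.map φ.toEquiv.toEmbedding) atTop atTop := by
    refine tendsto_atTop.2 fun T => ?_
    filter_upwards [eventually_ge_atTop (T.map φ.symm.toEquiv.toEmbedding)] with S hS v hv
    rw [Finset.mem_map_equiv]
    exact hS (Finset.mem_map_of_mem φ.symm.toEquiv.toEmbedding hv)
  refine tendsto_nhds_unique ((tendsto_matchPoly_erase_div hD hz (o := φ u)).comp hmap)
    ((tendsto_matchPoly_erase_div hD hz (o := u)).congr fun S => ?_)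
  have h2 : (S.map φ.toEquiv.toEmbedding).erase (φ u) =
      (S.erase u).map φ.toEquiv.toEmbedding := by
    rw [Finset.map_erase]; rfl
  simp only [Function.comp_apply]
  rw [h2, matchPoly_map, matchPoly_map]

end Main

theorem theorem1p1 {V : Type*} [Infinite V] (G : SimpleGraph V) (hconn : G.Connected)
    (htrans : IsVertexTransitive G) (D : ℕ) (hD : HasDegreeBound G D) (o : V) (θ : ℝ) :
    matchingMeasure G hD o {θ} = 0 := by
  classical
  by_contra hpos
  have hprob := (matchingMeasure_spec G hD o).isProbabilityMeasure
  set a := (matchingMeasure G hD o).real {θ} with ha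
  have ha0 : 0 < a := ENNReal.toReal_pos hpos (measure_ne_top _ _)
  obtain ⟨U, hε, hS, hlim⟩ := exists_ultrafilter_iterated_limit V
  choose c hc using fun T => exists_tendsto_matchRatio (G := G) (θ := θ) hε hS T
  refine false_of_limit_singleton_pos hD hconn hε hS hc ha0 fun u => ?_
  -- For fixed ε the limit over S is iε times the Stieltjes transform at u, which transitivity moves
  -- to `o`; then ε → 0 leaves the mass a.
  refine tendsto_nhds_unique (hc {u}) (hlim _ (fun ε : ℝ => Complex.I * ε *
    ∫ t : ℝ, (θ + Complex.I * ε - t : ℂ)⁻¹ ∂(matchingMeasure G hD o)) _ (fun ε hε => ?_)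
    ((matchingMeasure_spec G hD o).tendsto_mul_integral_inv θ))
  have hz : 0 < ((θ : ℂ) + Complex.I * ε).im := by simpa using hε
  obtain ⟨φ, rfl⟩ := htrans o u
  rw [← matchingMeasure_integral_inv_eq hD φ o hz]
  refine ((tendsto_matchPoly_erase_div hD hz (o := φ o)).const_mul _).congr fun S => ?_
  rw [matchRatio, Finset.card_singleton, pow_one, Finset.sdiff_singleton_eq_erase, mul_div_assoc]
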